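/- Let $D\ge 4$, let $\lambda\neq 0$ and $Q\neq 0$ be real constants, and let $m(r)$, $r>0$, be any solution of $$m'(r)=\frac1{\lambda^2}\Big(\sqrt{r^{2(D-2)}+\lambda^2Q^2}-r^{D-2}\Big).$$ Consider the electrically charged $D$-dimensional Born–Infeld black hole with metric $$ds^2=-f\,dt^2+f^{-1}dr^2+r^2d\Omega_{D-2}^2,\qquad f(r)=1-\frac{2m(r)}{r^{D-3}},$$ where $d\Omega^2_{D-2}$ is the metric of the unit round sphere $S^{D-2}$, and with Maxwell field $F_{tr}=-F_{rt}=Q/\sqrt{r^{2(D-2)}+\lambda^2Q^2}$ (other components zero). Let $$G^{\mu\nu}=-\frac{2}{\sqrt g}\frac{\partial L}{\partial F_{\mu\nu}},\qquad L=\sqrt g\,R+\frac1{\lambda^2}\Big(\sqrt g-\sqrt{|\det(g+\lambda F)|}\Big),\qquad \sqrt g=\sqrt{|\det g|},$$ be the Born–Infeld conjugate field; here $\partial L/\partial F_{\mu\nu}$ is the antisymmetric tensor with $\delta L=\sum_{\mu,\nu}(\partial L/\partial F_{\mu\nu})\,\delta F_{\mu\nu}$ for antisymmetric $\delta F$. For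 a two-form $F$ put $$C_{\mu\nu\rho\sigma}[F]=F_{\mu\nu}F_{\rho\sigma}-F_{\rho\mu}F_{\nu\sigma}-\frac{6}{D-2}g_{\mu\rho}F_\nu{}^{\lambda}F_{\sigma\lambda}+\frac{3}{(D-1)(D-2)}g_{\mu\rho}g_{\nu\sigma}F^{\alpha\beta}F_{\alpha\beta}\ \Big|_s ,$$ where $|_s$ means antisymmetrisation with unit weight in $\mu,\nu$ and in $\rho,\sigma$. The Weyl tensor is that of the Levi-Civita connection of the metric, with signature $(-,+,\dots,+)$ and curvature signs such that round spheres have positive Ricci tensor. Write $$B(r)=(D-1)(D-2)\,m(r)-2(D-2)\,r\,m'(r)+r^2m''(r).$$ (a) At every point with $r>0$ and $f(r)\neq0$: the only non-zero components of $G_{\mu\nu}$ are $G_{tr}=-G_{rt}=Q/r^{D-2}$; $$C_{\mu\nu\rho\sigma}=\Lambda(r)\,C_{\mu\nu\rho\sigma}[G],\qquad \Lambda(r)=-\frac{2r^{D-3}}{3Q^2}\,B(r);$$ and $$C^2:=C^{\mu\nu\rho\sigma}C_{\mu\nu\rho\sigma}=\frac{4(D-3)}{(D-1)\,r^{2(D-1)}}\,B(r)^2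 .$$ (b) The limit $m_0=\lim_{r\to0^+}m(r)$ exists and is finite; as $r\to0^+$ (with the other coordinates fixed), $$C^2\to+\infty,\qquad r^{2(D-1)}C^2\to 4(D-1)(D-2)^2(D-3)\,m_0^2 ,$$ so that, if $m_0\neq0$, $C^2$ diverges exactly like $r^{-2(D-1)}$ (that is, $C^2=\Theta(r^{-2(D-1)})$). On the other hand $F_{tr}$ stays finite, $F_{tr}\to Q/|\lambda Q|$. -/

import Mathlib

open Filter Topology Asymptotics

namespace BornInfeld

noncomputable section

/-! Local (pseudo-)Riemannian geometry in a coordinate chart. A point is a vector of coordinates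
`x : ι → ℝ`, a metric is a matrix-valued function `g`, with `g x a b` the component `g_{ab}(x)`. -/

/-- The partial derivative `∂_i f` at `x`. -/
def pderiv {ι : Type} [Fintype ι] [DecidableEq ι] (i : ι) (f : (ι → ℝ) → ℝ) (x : ι → ℝ) : ℝ :=
  fderiv ℝ f x (Pi.single i 1)

/-- The Christoffel symbol `Γ^a_{bc}` of the Levi-Civita connection. -/
def christoffel {ι : Type} [Fintype ι] [DecidableEq ι] (g : (ι → ℝ) → Matrix ι ι ℝ)
    (a b c : ι) (x : ι → ℝ) : ℝ :=
  (1 / 2) * ∑ e, (g x)⁻¹ a e *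
    (pderiv b (fun y => g y e c) x + pderiv c (fun y => g y e b) x - pderiv e (fun y => g y b c) x)

/-- The Riemann tensor `R^a_{bcd} = ∂_c Γ^a_{db} - ∂_d Γ^a_{cb} + Γ^a_{ce} Γ^e_{db} - Γ^a_{de} Γ^e_{cb}`. -/
def riemannUp {ι : Type} [Fintype ι] [DecidableEq ι] (g : (ι → ℝ) → Matrix ι ι ℝ)
    (x : ι → ℝ) (a b c d : ι) : ℝ :=
  pderiv c (christoffel g a d b) x - pderiv d (christoffel g a c b) x
    + ∑ e, (christoffel g a c e x * christoffel g e d b x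
      - christoffel g a d e x * christoffel g e c b x)

/-- The Riemann tensor `R_{abcd}` with all indices lowered. -/
def riemann {ι : Type} [Fintype ι] [DecidableEq ι] (g : (ι → ℝ) → Matrix ι ι ℝ)
    (x : ι → ℝ) (a b c d : ι) : ℝ :=
  ∑ e, g x a e * riemannUp g x e b c d

/-- The Ricci tensor `R_{bd} = R^a_{bad}`. -/
def ricci {ι : Type} [Fintype ι] [DecidableEq ι] (g : (ι → ℝ) → Matrix ι ι ℝ)
    (x : ι → ℝ) (b d : ι) : ℝ :=
  ∑ a, riemannUp g x a b a d

/-- The scalar curvature `R = g^{ab} R_{ab}`. -/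
def scalarCurvature {ι : Type} [Fintype ι] [DecidableEq ι] (g : (ι → ℝ) → Matrix ι ι ℝ)
    (x : ι → ℝ) : ℝ :=
  ∑ a, ∑ b, (g x)⁻¹ a b * ricci g x a b

/-- The Weyl tensor `C_{abcd}`, the trace-free part of `R_{abcd}`. -/
def weyl {ι : Type} [Fintype ι] [DecidableEq ι] (g : (ι → ℝ) → Matrix ι ι ℝ)
    (x : ι → ℝ) (a b c d : ι) : ℝ :=
  riemann g x a b c d
    - 1 / ((Fintype.card ι : ℝ) - 2) *
      (g x a c * ricci g x b d - g x a d * ricci g x b c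
        - g x b c * ricci g x a d + g x b d * ricci g x a c)
    + scalarCurvature g x / (((Fintype.card ι : ℝ) - 1) * ((Fintype.card ι : ℝ) - 2)) *
      (g x a c * g x b d - g x a d * g x b c)

/-- The full contraction `T^{abcd} T_{abcd}` of a 4-tensor with the metric matrix `h`. -/
def normSq4 {ι : Type} [Fintype ι] [DecidableEq ι] (h : Matrix ι ι ℝ) (T : ι → ι → ι → ι → ℝ) : ℝ :=
  ∑ a, ∑ b, ∑ c, ∑ d, ∑ a', ∑ b', ∑ c', ∑ d',
    h⁻¹ a a' * h⁻¹ b b' * h⁻¹ c c' * h⁻¹ d d' * T a' b' c' d' * T a b c d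

/-- The invariant `C² = C^{abcd} C_{abcd}`. -/
def weylSq {ι : Type} [Fintype ι] [DecidableEq ι] (g : (ι → ℝ) → Matrix ι ι ℝ) (x : ι → ℝ) : ℝ :=
  normSq4 (g x) (weyl g x)

/-- Antisymmetrisation, with unit weight, in the first and in the last pair of indices. -/
def antisymPairs {ι : Type} (T : ι → ι → ι → ι → ℝ) (a b c d : ι) : ℝ :=
  (1 / 4) * (T a b c d - T b a c d - T a b d c + T b a d c)

/-- The contraction `F_a^e F_{be}` of a two-form with itself. -/
def dot1 {ι : Type} [Fintype ι] [DecidableEq ι] (h F : Matrix ι ι ℝ) (a b : ι) : ℝ :=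
  ∑ e, ∑ e', h⁻¹ e e' * F a e' * F b e

/-- The contraction `F² = F^{ab} F_{ab}`. -/
def dot2 {ι : Type} [Fintype ι] [DecidableEq ι] (h F : Matrix ι ι ℝ) : ℝ :=
  ∑ a, ∑ b, h⁻¹ a b * dot1 h F a b

/-- The doubling tensor `C_{abcd}[F]` of a two-form `F`, with respect to the metric matrix `h`. -/
def doubling {ι : Type} [Fintype ι] [DecidableEq ι] (h F : Matrix ι ι ℝ) (a b c d : ι) : ℝ :=
  antisymPairs (fun a b c d =>
    F a b * F c d - F c a * F b d
      - 6 / ((Fintype.card ι : ℝ) - 2) * h a c * dot1 h F b d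
      + 3 / (((Fintype.card ι : ℝ) - 1) * ((Fintype.card ι : ℝ) - 2)) * h a c * h b d * dot2 h F)
    a b c d

/-- The Einstein-Born-Infeld Lagrangian density
`√g R + (1/λ²) (√g - √|det (g + λ F)|)` at the point `x`, as a function of the value `F` there. -/
def lagrangian {ι : Type} [Fintype ι] [DecidableEq ι] (lam : ℝ) (g : (ι → ℝ) → Matrix ι ι ℝ)
    (x : ι → ℝ) (F : Matrix ι ι ℝ) : ℝ :=
  √|(g x).det| * scalarCurvature g x
    + 1 / lam ^ 2 * (√|(g x).det| - √|(g x + lam • F).det|)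

/-- The derivative `∂L/∂F_{ab}` in the space of two-forms: the antisymmetric array with
`dL = ∑_{a,b} (∂L/∂F_{ab}) δF_{ab}` for every antisymmetric variation `δF`. -/
def dLagrangian {ι : Type} [Fintype ι] [DecidableEq ι] (lam : ℝ) (g : (ι → ℝ) → Matrix ι ι ℝ)
    (x : ι → ℝ) (F : Matrix ι ι ℝ) (a b : ι) : ℝ :=
  (1 / 2) * deriv (fun s : ℝ =>
    lagrangian lam g x (F + s • (Matrix.single a b (1 : ℝ) - Matrix.single b a (1 : ℝ)))) 0

/-- The Born-Infeld conjugate field `G^{ab} = -(2/√g) ∂L/∂F_{ab}`, with indices lowered. -/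
def conjugateField {ι : Type} [Fintype ι] [DecidableEq ι] (lam : ℝ) (g : (ι → ℝ) → Matrix ι ι ℝ)
    (F : (ι → ℝ) → Matrix ι ι ℝ) (x : ι → ℝ) : Matrix ι ι ℝ :=
  fun a b => ∑ c, ∑ d, g x a c * g x b d * (-(2 / √|(g x).det|) * dLagrangian lam g x (F x) c d)

/-! The unit round sphere `S^d` in stereographic coordinates. -/

/-- Inverse stereographic projection `ℝ^d → S^d ⊂ ℝ^(d+1)`; the last coordinate is `Sum.inr ()`. -/
def invStereo {d : ℕ} (k : Fin d ⊕ Unit) (u : Fin d → ℝ) : ℝ :=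
  match k with
  | Sum.inl i => 2 * u i / (1 + ∑ j, u j ^ 2)
  | Sum.inr _ => ((∑ j, u j ^ 2) - 1) / (1 + ∑ j, u j ^ 2)

/-- The round metric: the pull-back of the Euclidean metric of `ℝ^(d+1)` by `invStereo`. -/
def sphereMetric {d : ℕ} (u : Fin d → ℝ) : Matrix (Fin d) (Fin d) ℝ :=
  fun i j => ∑ k, pderiv i (invStereo k) u * pderiv j (invStereo k) u

theorem invStereo_mem_sphere {d : ℕ} (u : Fin d → ℝ) : ∑ k, invStereo k u ^ 2 = 1 := by
  have hs : 0 ≤ ∑ j, u j ^ 2 := Finset.sum_nonneg fun j _ => sq_nonneg _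
  have h : ∑ i, (2 * u i / (1 + ∑ j, u j ^ 2)) ^ 2
      = 4 * (∑ j, u j ^ 2) / (1 + ∑ j, u j ^ 2) ^ 2 := by
    rw [Finset.mul_sum, Finset.sum_div]
    exact Finset.sum_congr rfl fun i _ => by rw [div_pow]; ring
  simp only [Fintype.sum_sum_type, invStereo, Finset.univ_unique, Finset.sum_singleton, h]
  field_simp
  ring

theorem sphereMetric_eq {d : ℕ} (u : Fin d → ℝ) :
    sphereMetric u = (4 / (1 + ∑ j, u j ^ 2) ^ 2) • (1 : Matrix (Fin d) (Fin d) ℝ) := by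
  have hs : 0 ≤ ∑ j, u j ^ 2 := Finset.sum_nonneg fun j _ => sq_nonneg _
  have hN : (1 + ∑ j, u j ^ 2) ≠ 0 := by positivity
  have hproj : ∀ k : Fin d, HasFDerivAt (fun v : Fin d → ℝ => v k)
      (ContinuousLinearMap.proj (R := ℝ) (φ := fun _ : Fin d => ℝ) k) u := fun k =>
    (ContinuousLinearMap.proj (R := ℝ) (φ := fun _ : Fin d => ℝ) k).hasFDerivAt
  have hsum := HasFDerivAt.fun_sum (u := Finset.univ) fun (k : Fin d) _ => (hproj k).pow 2
  have hden := hsum.const_add 1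
  have hinv := (hasDerivAt_inv hN).comp_hasFDerivAt u hden
  have h1 : ∀ i k : Fin d, pderiv i (invStereo (Sum.inl k)) u
      = 2 * (if k = i then 1 else 0) / (1 + ∑ j, u j ^ 2)
        - 4 * u k * u i / (1 + ∑ j, u j ^ 2) ^ 2 := by
    intro i k
    have h := ((hproj k).const_mul 2).mul hinv
    have he : (invStereo (Sum.inl k) : (Fin d → ℝ) → ℝ)
        = (fun v : Fin d → ℝ => 2 * v k) * fun v => (1 + ∑ j, v j ^ 2)⁻¹ := by
      funext v
      simp [invStereo, div_eq_mul_inv]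
    rw [pderiv, he]
    erw [h.fderiv]
    simp [Pi.single_apply]
    split_ifs <;> field_simp <;> ring
  have h2 : ∀ i : Fin d, pderiv i (invStereo (Sum.inr ())) u
      = 4 * u i / (1 + ∑ j, u j ^ 2) ^ 2 := by
    intro i
    have h := (hsum.sub_const 1).mul hinv
    have he : (invStereo (Sum.inr ()) : (Fin d → ℝ) → ℝ)
        = (fun v : Fin d → ℝ => (∑ j, v j ^ 2) - 1) * fun v => (1 + ∑ j, v j ^ 2)⁻¹ := by
      funext v
      simp [invStereo, div_eq_mul_inv]
    rw [pderiv, he]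
    erw [h.fderiv]
    simp [Pi.single_apply]
    field_simp
    ring
  ext i j
  simp only [sphereMetric, Fintype.sum_sum_type, Finset.univ_unique, Finset.sum_singleton, h1, h2,
    Matrix.smul_apply, Matrix.one_apply, smul_eq_mul, PUnit.default_eq_unit]
  have h3 : ∑ x, (2 * (if x = i then (1 : ℝ) else 0) / (1 + ∑ j, u j ^ 2)
        - 4 * u x * u i / (1 + ∑ j, u j ^ 2) ^ 2)
      * (2 * (if x = j then (1 : ℝ) else 0) / (1 + ∑ j, u j ^ 2)
        - 4 * u x * u j / (1 + ∑ j, u j ^ 2) ^ 2)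
      = 4 * (if i = j then (1 : ℝ) else 0) / (1 + ∑ j, u j ^ 2) ^ 2
        - 16 * u i * u j / (1 + ∑ j, u j ^ 2) ^ 3
        + 16 * u i * u j * (∑ j, u j ^ 2) / (1 + ∑ j, u j ^ 2) ^ 4 := by
    generalize hN' : (1 + ∑ j, u j ^ 2) = N
    have : ∀ x, (2 * (if x = i then (1 : ℝ) else 0) / N - 4 * u x * u i / N ^ 2)
        * (2 * (if x = j then (1 : ℝ) else 0) / N - 4 * u x * u j / N ^ 2)
        = (if x = i then 4 * (if x = j then (1 : ℝ) else 0) / N ^ 2 else 0)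
          - (if x = i then 8 * u x * u j / N ^ 3 else 0)
          - (if x = j then 8 * u x * u i / N ^ 3 else 0)
          + 16 * u i * u j / N ^ 4 * u x ^ 2 := by
      intro x
      split_ifs <;> ring
    simp only [this, Finset.sum_add_distrib, Finset.sum_sub_distrib, Finset.sum_ite_eq',
      Finset.mem_univ, if_true, ← Finset.mul_sum]
    ring
  rw [h3]
  field_simp
  ring

/-! The Born-Infeld black hole in dimension `D`, in coordinates `(t, r, u)` with `u` stereographic
coordinates on `S^(D-2)`. -/

/-- Coordinate labels: `Sum.inl 0` is `t`, `Sum.inl 1` is `r`, `Sum.inr i` is `u_i`. -/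
abbrev Idx (D : ℕ) : Type := Fin 2 ⊕ Fin (D - 2)

/-- The point with coordinates `(t, r, u)`. -/
def point {D : ℕ} (t r : ℝ) (u : Fin (D - 2) → ℝ) : Idx D → ℝ := Sum.elim ![t, r] u

/-- `f(r) = 1 - 2 m(r) / r^(D-3)`. -/
def lapse (D : ℕ) (m : ℝ → ℝ) (r : ℝ) : ℝ := 1 - 2 * m r / r ^ (D - 3)

/-- The metric `-f dt² + f⁻¹ dr² + r² dΩ²_{D-2}`. -/
def metric (D : ℕ) (m : ℝ → ℝ) (x : Idx D → ℝ) : Matrix (Idx D) (Idx D) ℝ :=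
  Matrix.fromBlocks
    !![-lapse D m (x (Sum.inl 1)), 0; 0, (lapse D m (x (Sum.inl 1)))⁻¹] 0
    0 (x (Sum.inl 1) ^ 2 • sphereMetric (fun i => x (Sum.inr i)))

/-- The two-form with `F_{tr} = -F_{rt} = E` and all other components zero. -/
def radialForm (D : ℕ) (E : ℝ) : Matrix (Idx D) (Idx D) ℝ :=
  Matrix.fromBlocks !![0, E; -E, 0] 0 0 0

/-- The electric field `F_{tr} = Q / √(r^(2(D-2)) + λ² Q²)`. -/
def electricField (D : ℕ) (lam Q r : ℝ) : ℝ := Q / √(r ^ (2 * (D - 2)) + lam ^ 2 * Q ^ 2)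

/-- The Maxwell field of the black hole. -/
def maxwell (D : ℕ) (lam Q : ℝ) (x : Idx D → ℝ) : Matrix (Idx D) (Idx D) ℝ :=
  radialForm D (electricField D lam Q (x (Sum.inl 1)))

/-- The mass-function equation `m'(r) = (1/λ²) (√(r^(2(D-2)) + λ² Q²) - r^(D-2))` on `r > 0`. -/
def IsMassFunction (D : ℕ) (lam Q : ℝ) (m : ℝ → ℝ) : Prop :=
  ∀ r : ℝ, 0 < r → HasDerivAt m
    (1 / lam ^ 2 * (√(r ^ (2 * (D - 2)) + lam ^ 2 * Q ^ 2) - r ^ (D - 2))) r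

/-- `(D-1)(D-2) m - 2(D-2) r m' + r² m''`. -/
def massBracket (D : ℕ) (m : ℝ → ℝ) (r : ℝ) : ℝ :=
  ((D : ℝ) - 1) * ((D : ℝ) - 2) * m r - 2 * ((D : ℝ) - 2) * r * deriv m r
    + r ^ 2 * deriv (deriv m) r

end

end BornInfeld

/-! Part (a) rests on symmetry. For the metric `-f dt² + f⁻¹ dr² + r² dΩ²` the Riemann tensor is
`K_{ab} (g_{ac} g_{bd} - g_{ad} g_{bc})`, with `K` equal to `-f''/2` on the `(t, r)` plane,
`-f'/(2r)` on mixed planes and `(1 - f)/r²` on angular planes (`riemannUp_metric`). A tensor of this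
form has three free values; trace-freeness leaves one. The Weyl tensor (`weylSectional_sectional`)
and the doubling tensor of a radial two-form (`doubling_radialForm`) are both trace-free of this
form, so each is a multiple of `traceFreeProfile`. The ratio of the two multiples is `Λ`, and the
sum of squares of the profile gives `C²`. The conjugate field has only a `tr` component: reflecting
one angular coordinate makes the Lagrangian even in every variation with an angular index. In the
`tr` direction `|det (g + λF)| = (1 - λ²E²) |det g|`, whence `G_{tr} = E/√(1 - λ²E²) = Q/r^(D-2)`.
Part (b) uses that `m'` is given by a function continuous across `r = 0`, so `m` extends to a
differentiable `M` on the whole line and `m₀ = M 0`. If `m₀ ≠ 0`, then `B → (D-1)(D-2) m₀` and `C²`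
grows like `r^(-2(D-1))`. If `m₀ = 0`, then `B/r` has a non-zero limit, because `m'(0) = |λQ|/λ² >
0`, and `C²` still diverges, like `r^(-2(D-2))`. The formula for `C²` needs `f ≠ 0`, so it must also
be shown that no horizons accumulate at the origin (`lapse_eventually_ne_zero`). -/

namespace BornInfeld

noncomputable section

/-! ### Curvature algebra of a diagonal metric with prescribed sectional curvatures. -/

section DiagonalMetric

variable {ι : Type} [Fintype ι] [DecidableEq ι]

theorem inv_diagonal_apply (h : ι → ℝ) (hh : ∀ a, h a ≠ 0) (a b : ι) :
    (Matrix.diagonal h)⁻¹ a b = if a = b then (h a)⁻¹ else 0 := by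
  have : (Matrix.diagonal h)⁻¹ = Matrix.diagonal fun a => (h a)⁻¹ := by
    apply Matrix.inv_eq_right_inv
    rw [Matrix.diagonal_mul_diagonal, ← Matrix.diagonal_one]
    congr 1
    funext a
    exact mul_inv_cancel₀ (hh a)
  rw [this, Matrix.diagonal_apply]

/-- The Ricci eigenvalues of a metric with sectional curvatures `K`. -/
def ricciEigenvalue (K : ι → ι → ℝ) (b : ι) : ℝ := ∑ a, K a b - K b b

/-- The sectional components of the Weyl tensor of a metric with sectional curvatures `K`. -/
def weylSectional (K : ι → ι → ℝ) (a b : ι) : ℝ :=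
  K a b - 1 / ((Fintype.card ι : ℝ) - 2) * (ricciEigenvalue K a + ricciEigenvalue K b)
    + (∑ c, ricciEigenvalue K c) / (((Fintype.card ι : ℝ) - 1) * ((Fintype.card ι : ℝ) - 2))

variable {g : (ι → ℝ) → Matrix ι ι ℝ} {x : ι → ℝ} {h : ι → ℝ} {K : ι → ι → ℝ}

theorem riemann_of_sectional (hg : g x = Matrix.diagonal h)
    (hR : ∀ a b c d, riemannUp g x a b c d = K a b *
      ((if a = c then 1 else 0) * g x b d - (if a = d then 1 else 0) * g x b c))
    (a b c d : ι) :
    riemann g x a b c d = K a b * (g x a c * g x b d - g x a d * g x b c) := by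
  simp only [riemann, hR, hg, Matrix.diagonal_apply]
  simp only [ite_mul, zero_mul, Finset.sum_ite_eq, Finset.mem_univ, if_true]
  split_ifs <;> ring

/-- The value `K b b` multiplies a vanishing expression in the Riemann tensor and is therefore
arbitrary; this is why `ricciEigenvalue` removes it from the sum. -/
theorem ricci_of_sectional (hg : g x = Matrix.diagonal h)
    (hR : ∀ a b c d, riemannUp g x a b c d = K a b *
      ((if a = c then 1 else 0) * g x b d - (if a = d then 1 else 0) * g x b c))
    (b d : ι) : ricci g x b d = ricciEigenvalue K b * g x b d := by
  have : ∀ a, riemannUp g x a b a d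
      = K a b * g x b d - (if a = d then K a b * g x b a else 0) := by
    intro a
    rw [hR]
    split_ifs <;> simp_all
  simp only [ricci, this, Finset.sum_sub_distrib, Finset.sum_ite_eq', Finset.mem_univ,
    if_true, ricciEigenvalue, ← Finset.sum_mul]
  by_cases hbd : b = d
  · subst hbd; ring
  · simp [hg, hbd]

theorem scalarCurvature_of_sectional (hg : g x = Matrix.diagonal h) (hh : ∀ a, h a ≠ 0)
    (hR : ∀ a b c d, riemannUp g x a b c d = K a b *
      ((if a = c then 1 else 0) * g x b d - (if a = d then 1 else 0) * g x b c)) :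
    scalarCurvature g x = ∑ a, ricciEigenvalue K a := by
  simp only [scalarCurvature, ricci_of_sectional hg hR]
  simp only [hg, inv_diagonal_apply h hh, ite_mul, zero_mul, Finset.sum_ite_eq, Finset.mem_univ,
    if_true, Matrix.diagonal_apply_eq]
  refine Finset.sum_congr rfl fun a _ => ?_
  field_simp [hh a]

theorem weyl_of_sectional (hg : g x = Matrix.diagonal h) (hh : ∀ a, h a ≠ 0)
    (hR : ∀ a b c d, riemannUp g x a b c d = K a b *
      ((if a = c then 1 else 0) * g x b d - (if a = d then 1 else 0) * g x b c))
    (a b c d : ι) :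
    weyl g x a b c d = weylSectional K a b * (g x a c * g x b d - g x a d * g x b c) := by
  rw [weyl, riemann_of_sectional hg hR, scalarCurvature_of_sectional hg hh hR]
  simp only [ricci_of_sectional hg hR, weylSectional]
  ring

theorem normSq4_of_sectional (hh : ∀ a, h a ≠ 0) (W : ι → ι → ℝ) :
    normSq4 (Matrix.diagonal h) (fun a b c d => W a b *
        (Matrix.diagonal h a c * Matrix.diagonal h b d
          - Matrix.diagonal h a d * Matrix.diagonal h b c))
      = 2 * ∑ a, (∑ b, W a b ^ 2 - W a a ^ 2) := by
  simp only [normSq4, inv_diagonal_apply h hh]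
  simp only [ite_mul, mul_ite, zero_mul, mul_zero, Finset.sum_ite_eq, Finset.mem_univ, if_true]
  -- Only `(c, d) = (a, b)` and `(c, d) = (b, a)` contribute. The last term removes the case `a =
  -- b`, which both count although the tensor vanishes there.
  have key : ∀ a b c d, (h a)⁻¹ * (h b)⁻¹ * (h c)⁻¹ * (h d)⁻¹ *
      (W a b * (Matrix.diagonal h a c * Matrix.diagonal h b d
          - Matrix.diagonal h a d * Matrix.diagonal h b c)) *
      (W a b * (Matrix.diagonal h a c * Matrix.diagonal h b d
          - Matrix.diagonal h a d * Matrix.diagonal h b c))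
      = (if b = d then (if a = c then W a b ^ 2 else 0) else 0)
        + (if a = d then (if b = c then W a b ^ 2 else 0) else 0)
        - 2 * (if a = d then (if a = c then (if a = b then W a b ^ 2 else 0) else 0) else 0) := by
    intro a b c d
    have := hh a
    have := hh b
    have := hh c
    have := hh d
    simp only [Matrix.diagonal_apply]
    split_ifs <;> subst_vars <;> first | contradiction | (field_simp; ring)
  simp only [key, Finset.sum_add_distrib, Finset.sum_sub_distrib, ← Finset.mul_sum,
    Finset.sum_ite_eq, Finset.mem_univ, if_true]
  ring

theorem weylSq_of_sectional (hg : g x = Matrix.diagonal h) (hh : ∀ a, h a ≠ 0)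
    (hR : ∀ a b c d, riemannUp g x a b c d = K a b *
      ((if a = c then 1 else 0) * g x b d - (if a = d then 1 else 0) * g x b c)) :
    weylSq g x = 2 * ∑ a, (∑ b, weylSectional K a b ^ 2 - weylSectional K a a ^ 2) := by
  have : weyl g x = fun a b c d => weylSectional K a b *
      (g x a c * g x b d - g x a d * g x b c) := by
    funext a b c d
    exact weyl_of_sectional hg hh hR a b c d
  rw [weylSq, this, hg, normSq4_of_sectional hh]

end DiagonalMetric

section

/-! Conformally flat data of the unit sphere in stereographic coordinates. -/

/-- The conformal factor of the round metric in stereographic coordinates. -/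
def conformalFactor {d : ℕ} (u : Fin d → ℝ) : ℝ := 4 / (1 + ∑ j, u j ^ 2) ^ 2

/-- The Christoffel symbols of the round metric in stereographic coordinates. -/
def sphereChristoffel {d : ℕ} (i j k : Fin d) (u : Fin d → ℝ) : ℝ :=
  -2 * ((if i = j then u k else 0) + (if i = k then u j else 0) - (if j = k then u i else 0))
    / (1 + ∑ l, u l ^ 2)

theorem one_add_sum_sq_pos {d : ℕ} (u : Fin d → ℝ) : 0 < 1 + ∑ j, u j ^ 2 := by
  have : 0 ≤ ∑ j, u j ^ 2 := Finset.sum_nonneg fun j _ => sq_nonneg _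
  linarith

theorem conformalFactor_pos {d : ℕ} (u : Fin d → ℝ) : 0 < conformalFactor u := by
  have := one_add_sum_sq_pos u
  unfold conformalFactor
  positivity

theorem pderiv_coord {ι : Type} [Fintype ι] [DecidableEq ι] (i k : ι) (x : ι → ℝ) :
    pderiv i (fun v => v k) x = if k = i then 1 else 0 := by
  have : HasFDerivAt (fun v : ι → ℝ => v k)
      (ContinuousLinearMap.proj (R := ℝ) (φ := fun _ : ι => ℝ) k) x :=
    (ContinuousLinearMap.proj (R := ℝ) (φ := fun _ : ι => ℝ) k).hasFDerivAt
  rw [pderiv, this.fderiv]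
  simp [Pi.single_apply]

theorem pderiv_mul {ι : Type} [Fintype ι] [DecidableEq ι] {φ ψ : (ι → ℝ) → ℝ} {x : ι → ℝ}
    (hφ : DifferentiableAt ℝ φ x) (hψ : DifferentiableAt ℝ ψ x) (i : ι) :
    pderiv i (fun v => φ v * ψ v) x = pderiv i φ x * ψ x + φ x * pderiv i ψ x := by
  simp only [pderiv]
  rw [fderiv_fun_mul hφ hψ]
  simp
  ring

theorem pderiv_comp {ι : Type} [Fintype ι] [DecidableEq ι] {φ : (ι → ℝ) → ℝ} {x : ι → ℝ}
    {F : ℝ → ℝ} {F' : ℝ} (hF : HasDerivAt F F' (φ x)) (hφ : DifferentiableAt ℝ φ x) (i : ι) :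
    pderiv i (fun v => F (φ v)) x = F' * pderiv i φ x := by
  have := hF.comp_hasFDerivAt x hφ.hasFDerivAt
  simp only [pderiv]
  erw [this.fderiv]
  simp

theorem differentiableAt_one_add_sum_sq {d : ℕ} (u : Fin d → ℝ) :
    DifferentiableAt ℝ (fun v : Fin d → ℝ => 1 + ∑ j, v j ^ 2) u := by
  fun_prop

theorem pderiv_one_add_sum_sq {d : ℕ} (k : Fin d) (u : Fin d → ℝ) :
    pderiv k (fun v : Fin d → ℝ => 1 + ∑ j, v j ^ 2) u = 2 * u k := by
  have hsum := HasFDerivAt.fun_sum (u := Finset.univ) fun (k : Fin d) _ =>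
    ((ContinuousLinearMap.proj (R := ℝ) (φ := fun _ : Fin d => ℝ) k).hasFDerivAt (x := u)).pow 2
  have h := hsum.const_add 1
  rw [pderiv]
  erw [h.fderiv]
  simp [Pi.single_apply]

theorem hasDerivAt_four_div_sq {s : ℝ} (hs : s ≠ 0) :
    HasDerivAt (fun s : ℝ => 4 / s ^ 2) (-8 / s ^ 3) s := by
  refine ((hasDerivAt_const s (4 : ℝ)).fun_div (hasDerivAt_pow 2 s)
    (pow_ne_zero 2 hs)).congr_deriv ?_
  field_simp
  norm_num
  ring

theorem differentiableAt_conformalFactor {d : ℕ} (u : Fin d → ℝ) :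
    DifferentiableAt ℝ conformalFactor u :=
  DifferentiableAt.comp (g := fun s : ℝ => 4 / s ^ 2) u
    (hasDerivAt_four_div_sq (one_add_sum_sq_pos u).ne').differentiableAt
    (differentiableAt_one_add_sum_sq u)

theorem pderiv_conformalFactor {d : ℕ} (k : Fin d) (u : Fin d → ℝ) :
    pderiv k conformalFactor u = -4 * u k / (1 + ∑ j, u j ^ 2) * conformalFactor u := by
  have hN := (one_add_sum_sq_pos u).ne'
  unfold conformalFactor
  rw [pderiv_comp (F := fun s : ℝ => 4 / s ^ 2) (hasDerivAt_four_div_sq hN)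
    (differentiableAt_one_add_sum_sq u), pderiv_one_add_sum_sq]
  field_simp
  ring

theorem differentiableAt_sphereChristoffel {d : ℕ} (i j k : Fin d) (u : Fin d → ℝ) :
    DifferentiableAt ℝ (sphereChristoffel i j k) u := by
  have hN := (one_add_sum_sq_pos u).ne'
  unfold sphereChristoffel
  split_ifs <;> fun_prop (disch := assumption)

theorem pderiv_sphereChristoffel {d : ℕ} (l i j k : Fin d) (u : Fin d → ℝ) :
    pderiv l (sphereChristoffel i j k) u
      = -2 * ((if i = j then (if k = l then 1 else 0) else 0)
          + (if i = k then (if j = l then 1 else 0) else 0)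
          - (if j = k then (if i = l then 1 else 0) else 0)) / (1 + ∑ m, u m ^ 2)
        - 2 * u l / (1 + ∑ m, u m ^ 2) * sphereChristoffel i j k u := by
  have hN := (one_add_sum_sq_pos u).ne'
  -- The numerator of the Christoffel symbol is linear in `u`, so its derivative along a coordinate
  -- is its value at the basis vector.
  let L : (Fin d → ℝ) →L[ℝ] ℝ := (-2 : ℝ) • (((if i = j then (1 : ℝ) else 0) •
            ContinuousLinearMap.proj (R := ℝ) (φ := fun _ : Fin d => ℝ) k
          + (if i = k then (1 : ℝ) else 0) • ContinuousLinearMap.proj j)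
          - (if j = k then (1 : ℝ) else 0) • ContinuousLinearMap.proj i)
  have hL : ∀ v, L v = -2 * ((if i = j then v k else 0) + (if i = k then v j else 0)
      - (if j = k then v i else 0)) := by
    intro v
    change (-2 : ℝ) * ((((if i = j then (1 : ℝ) else 0) * v k
          + (if i = k then (1 : ℝ) else 0) * v j)
          - (if j = k then (1 : ℝ) else 0) * v i)) = _
    simp only [ite_mul, one_mul, zero_mul]
  have he : sphereChristoffel i j k = fun v => L v * (1 + ∑ m, v m ^ 2)⁻¹ := by
    funext v
    rw [hL, sphereChristoffel, div_eq_mul_inv]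
  have hinv : DifferentiableAt ℝ (fun v : Fin d → ℝ => (1 + ∑ j, v j ^ 2)⁻¹) u :=
    (differentiableAt_one_add_sum_sq u).inv hN
  have hpL : pderiv l L u = L (Pi.single l 1) := by
    rw [pderiv, L.fderiv]
  rw [he, pderiv_mul L.differentiableAt hinv,
    pderiv_comp (hasDerivAt_inv hN) (differentiableAt_one_add_sum_sq u), pderiv_one_add_sum_sq, hpL]
  rw [hL (Pi.single l 1)]
  simp only [Pi.single_apply]
  field_simp
  ring

/-- The unit sphere has constant curvature one. -/
theorem sphere_curvature {d : ℕ} (i j k l : Fin d) (u : Fin d → ℝ) :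
    pderiv k (sphereChristoffel i l j) u - pderiv l (sphereChristoffel i k j) u
      + ∑ m, (sphereChristoffel i k m u * sphereChristoffel m l j u
        - sphereChristoffel i l m u * sphereChristoffel m k j u)
      = conformalFactor u * ((if i = k then 1 else 0) * (if j = l then 1 else 0)
          - (if i = l then 1 else 0) * (if j = k then 1 else 0)) := by
  have hN := (one_add_sum_sq_pos u).ne'
  -- The contraction over `m` is carried out once; the two quadratic terms of the curvature differ
  -- by exchanging `k` and `l`.
  have hprod : ∀ k l : Fin d, ∑ m, sphereChristoffel i k m u * sphereChristoffel m l j u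
      = 4 / (1 + ∑ m, u m ^ 2) ^ 2 *
        ((if i = k then 1 else 0) * (2 * u l * u j
            - (if l = j then 1 else 0) * ∑ m, u m ^ 2)
          + u k * ((if i = l then 1 else 0) * u j + (if i = j then 1 else 0) * u l
            - (if l = j then 1 else 0) * u i)
          - u i * ((if k = l then 1 else 0) * u j + (if k = j then 1 else 0) * u l
            - (if l = j then 1 else 0) * u k)) := by
    intro k l
    have h1 : ∀ m, sphereChristoffel i k m u * sphereChristoffel m l j u
        = 4 / (1 + ∑ m, u m ^ 2) ^ 2 *
          ((if i = k then 1 else 0) * ((if m = l then u m * u j else 0)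
              + (if m = j then u m * u l else 0) - (if l = j then 1 else 0) * u m ^ 2)
            + u k * ((if i = m then (if m = l then u j else 0) + (if m = j then u l else 0)
              - (if l = j then 1 else 0) * u m else 0))
            - u i * ((if k = m then (if m = l then u j else 0) + (if m = j then u l else 0)
              - (if l = j then 1 else 0) * u m else 0))) := by
      intro m
      unfold sphereChristoffel
      split_ifs <;> field_simp <;> ring
    simp only [h1, ← Finset.mul_sum, Finset.sum_add_distrib, Finset.sum_sub_distrib,
      Finset.sum_ite_eq, Finset.sum_ite_eq', Finset.mem_univ, if_true]
    split_ifs <;> ring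
  rw [Finset.sum_sub_distrib, hprod, hprod, pderiv_sphereChristoffel, pderiv_sphereChristoffel]
  unfold sphereChristoffel conformalFactor
  -- Once `|u|²` is expressed through `N = 1 + |u|²`, the identity is rational in an opaque `N ≠ 0`.
  have hs : ∑ m, u m ^ 2 = (1 + ∑ m, u m ^ 2) - 1 := by ring
  rw [hs, add_sub_cancel]
  generalize 1 + ∑ m, u m ^ 2 = N at *
  simp only [eq_comm (a := l) (b := j), eq_comm (a := k) (b := j), eq_comm (a := l) (b := k)]
  split_ifs <;> subst_vars <;> first | contradiction | (field_simp; ring)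

end

/-! ### Separation of variables and the Christoffel symbols of the black-hole metric. -/

section

theorem Idx.cases {D : ℕ} {P : Idx D → Prop} (t : P (Sum.inl 0)) (r : P (Sum.inl 1))
    (u : ∀ i, P (Sum.inr i)) : ∀ a, P a
  | Sum.inl 0 => t
  | Sum.inl 1 => r
  | Sum.inr i => u i

theorem Idx.sum_univ {D : ℕ} (F : Idx D → ℝ) :
    ∑ a, F a = F (Sum.inl 0) + F (Sum.inl 1) + ∑ i, F (Sum.inr i) := by
  rw [Fintype.sum_sum_type, Fin.sum_univ_two]

/-- The derivative along a coordinate of a product of a function of `r` and a function of the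
angular coordinates. -/
def separatedDeriv {D : ℕ} (A A' : ℝ → ℝ) (B : (Fin (D - 2) → ℝ) → ℝ) (x : Idx D → ℝ) :
    Idx D → ℝ
  | Sum.inl 0 => 0
  | Sum.inl 1 => A' (x (Sum.inl 1)) * B fun i => x (Sum.inr i)
  | Sum.inr k => A (x (Sum.inl 1)) * pderiv k B fun i => x (Sum.inr i)

/-- Metric components and Christoffel symbols are all products of a radial and an angular factor, so
this one rule supplies every partial derivative in the curvature computation. -/
theorem pderiv_separated {D : ℕ} {A A' : ℝ → ℝ} {B : (Fin (D - 2) → ℝ) → ℝ} {x : Idx D → ℝ}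
    (hA : HasDerivAt A (A' (x (Sum.inl 1))) (x (Sum.inl 1)))
    (hB : DifferentiableAt ℝ B fun i => x (Sum.inr i)) (e : Idx D) :
    pderiv e (fun y => A (y (Sum.inl 1)) * B fun i => y (Sum.inr i)) x
      = separatedDeriv A A' B x e := by
  let P : (Idx D → ℝ) →L[ℝ] (Fin (D - 2) → ℝ) :=
    ContinuousLinearMap.pi fun i => ContinuousLinearMap.proj (Sum.inr i)
  have hr : DifferentiableAt ℝ (fun y : Idx D → ℝ => y (Sum.inl 1)) x := by fun_prop
  have hBP : HasFDerivAt (fun y : Idx D → ℝ => B fun i => y (Sum.inr i))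
      ((fderiv ℝ B fun i => x (Sum.inr i)).comp P) x :=
    HasFDerivAt.comp (g := B) (f := P) x hB.hasFDerivAt P.hasFDerivAt
  have hA' : DifferentiableAt ℝ (fun y : Idx D → ℝ => A (y (Sum.inl 1))) x :=
    DifferentiableAt.comp (g := A) x hA.differentiableAt hr
  have hpB : ∀ e, pderiv e (fun y : Idx D → ℝ => B fun i => y (Sum.inr i)) x
      = fderiv ℝ B (fun i => x (Sum.inr i)) fun i => (Pi.single e 1 : Idx D → ℝ) (Sum.inr i) := by
    intro e
    rw [pderiv, hBP.fderiv]
    rfl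
  rw [pderiv_mul hA' hBP.differentiableAt, pderiv_comp hA hr, pderiv_coord, hpB]
  induction e using Idx.cases with
  | t => simp [separatedDeriv, ← Pi.zero_def]
  | r => simp [separatedDeriv, ← Pi.zero_def]
  | u k =>
    have : (fun i => (Pi.single (Sum.inr k) 1 : Idx D → ℝ) (Sum.inr i))
        = (Pi.single k 1 : Fin (D - 2) → ℝ) := by
      funext i
      simp [Pi.single_apply]
    simp [separatedDeriv, this, pderiv]

/-- The radial factors of the metric components. -/
def metricRadial {D : ℕ} (f : ℝ → ℝ) : Idx D → Idx D → ℝ → ℝ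
  | Sum.inl 0, Sum.inl 0, r => -f r
  | Sum.inl 1, Sum.inl 1, r => (f r)⁻¹
  | Sum.inr _, Sum.inr _, r => r ^ 2
  | _, _, _ => 0

/-- The derivatives of the radial factors of the metric components. -/
def metricRadialDeriv {D : ℕ} (f f' : ℝ → ℝ) : Idx D → Idx D → ℝ → ℝ
  | Sum.inl 0, Sum.inl 0, r => -f' r
  | Sum.inl 1, Sum.inl 1, r => -f' r / f r ^ 2
  | Sum.inr _, Sum.inr _, r => 2 * r
  | _, _, _ => 0

/-- The angular factors of the metric components. -/
def metricAngular {D : ℕ} : Idx D → Idx D → (Fin (D - 2) → ℝ) → ℝ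
  | Sum.inr i, Sum.inr j, u => conformalFactor u * if i = j then 1 else 0
  | Sum.inl _, Sum.inl _, _ => 1
  | _, _, _ => 0

/-- The diagonal entries of the metric. -/
def metricDiag {D : ℕ} (f : ℝ → ℝ) (x : Idx D → ℝ) : Idx D → ℝ
  | Sum.inl 0 => -f (x (Sum.inl 1))
  | Sum.inl 1 => (f (x (Sum.inl 1)))⁻¹
  | Sum.inr _ => x (Sum.inl 1) ^ 2 * conformalFactor fun i => x (Sum.inr i)

theorem metric_eq_diagonal (D : ℕ) (m : ℝ → ℝ) (x : Idx D → ℝ) :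
    metric D m x = Matrix.diagonal (metricDiag (lapse D m) x) := by
  ext a b
  induction a using Idx.cases <;> induction b using Idx.cases <;>
    simp [metric, metricDiag, sphereMetric_eq, Matrix.diagonal_apply, conformalFactor,
      Matrix.one_apply]

theorem metricDiag_ne_zero {D : ℕ} {f : ℝ → ℝ} {x : Idx D → ℝ} (hr : 0 < x (Sum.inl 1))
    (hf : f (x (Sum.inl 1)) ≠ 0) (a : Idx D) : metricDiag f x a ≠ 0 := by
  have := conformalFactor_pos fun i => x (Sum.inr i)
  induction a using Idx.cases <;> simp [metricDiag, hf, hr.ne', this.ne']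

theorem metric_eq_separated (D : ℕ) (m : ℝ → ℝ) (a b : Idx D) :
    (fun x => metric D m x a b) = fun x => metricRadial (lapse D m) a b (x (Sum.inl 1))
      * metricAngular a b fun i => x (Sum.inr i) := by
  funext x
  rw [metric_eq_diagonal]
  induction a using Idx.cases <;> induction b using Idx.cases <;>
    simp [metricDiag, metricRadial, metricAngular, Matrix.diagonal_apply]

theorem differentiableAt_metricAngular {D : ℕ} (a b : Idx D) (u : Fin (D - 2) → ℝ) :
    DifferentiableAt ℝ (metricAngular a b) u := by
  induction a using Idx.cases <;> induction b using Idx.cases <;> unfold metricAngular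
  any_goals exact differentiableAt_const _
  exact (differentiableAt_conformalFactor u).mul_const _

theorem hasDerivAt_metricRadial {D : ℕ} {f f' : ℝ → ℝ} {r : ℝ} (hf : HasDerivAt f (f' r) r)
    (h0 : f r ≠ 0) (a b : Idx D) :
    HasDerivAt (metricRadial f a b) (metricRadialDeriv f f' a b r) r := by
  induction a using Idx.cases <;> induction b using Idx.cases <;>
    unfold metricRadial metricRadialDeriv
  any_goals exact hasDerivAt_const _ _
  · exact hf.neg
  · exact hf.inv h0
  · simpa using hasDerivAt_pow 2 r

/-- The radial factors of the Christoffel symbols. -/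
def christoffelRadial {D : ℕ} (f f' : ℝ → ℝ) : Idx D → Idx D → Idx D → ℝ → ℝ
  | Sum.inl 0, Sum.inl 0, Sum.inl 1, r => f' r / (2 * f r)
  | Sum.inl 0, Sum.inl 1, Sum.inl 0, r => f' r / (2 * f r)
  | Sum.inl 1, Sum.inl 0, Sum.inl 0, r => f r * f' r / 2
  | Sum.inl 1, Sum.inl 1, Sum.inl 1, r => -f' r / (2 * f r)
  | Sum.inl 1, Sum.inr _, Sum.inr _, r => -f r * r
  | Sum.inr _, Sum.inl 1, Sum.inr _, r => 1 / r
  | Sum.inr _, Sum.inr _, Sum.inl 1, r => 1 / r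
  | Sum.inr _, Sum.inr _, Sum.inr _, _ => 1
  | _, _, _, _ => 0

/-- The derivatives of the radial factors of the Christoffel symbols. -/
def christoffelRadialDeriv {D : ℕ} (f f' f'' : ℝ → ℝ) : Idx D → Idx D → Idx D → ℝ → ℝ
  | Sum.inl 0, Sum.inl 0, Sum.inl 1, r => (f'' r * f r - f' r ^ 2) / (2 * f r ^ 2)
  | Sum.inl 0, Sum.inl 1, Sum.inl 0, r => (f'' r * f r - f' r ^ 2) / (2 * f r ^ 2)
  | Sum.inl 1, Sum.inl 0, Sum.inl 0, r => (f' r ^ 2 + f r * f'' r) / 2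
  | Sum.inl 1, Sum.inl 1, Sum.inl 1, r => -(f'' r * f r - f' r ^ 2) / (2 * f r ^ 2)
  | Sum.inl 1, Sum.inr _, Sum.inr _, r => -f' r * r - f r
  | Sum.inr _, Sum.inl 1, Sum.inr _, r => -1 / r ^ 2
  | Sum.inr _, Sum.inr _, Sum.inl 1, r => -1 / r ^ 2
  | _, _, _, _ => 0

/-- The angular factors of the Christoffel symbols. -/
def christoffelAngular {D : ℕ} : Idx D → Idx D → Idx D → (Fin (D - 2) → ℝ) → ℝ
  | Sum.inl _, Sum.inl _, Sum.inl _, _ => 1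
  | Sum.inl 1, Sum.inr i, Sum.inr j, u => conformalFactor u * if i = j then 1 else 0
  | Sum.inr i, Sum.inl 1, Sum.inr j, _ => if i = j then 1 else 0
  | Sum.inr i, Sum.inr j, Sum.inl 1, _ => if i = j then 1 else 0
  | Sum.inr i, Sum.inr j, Sum.inr k, u => sphereChristoffel i j k u
  | _, _, _, _ => 0

theorem differentiableAt_christoffelAngular {D : ℕ} (a b c : Idx D) (u : Fin (D - 2) → ℝ) :
    DifferentiableAt ℝ (christoffelAngular a b c) u := by
  induction a using Idx.cases <;> induction b using Idx.cases <;>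
    induction c using Idx.cases <;> unfold christoffelAngular
  any_goals exact differentiableAt_const _
  · exact (differentiableAt_conformalFactor u).mul_const _
  · exact differentiableAt_sphereChristoffel _ _ _ u

theorem hasDerivAt_christoffelRadial {D : ℕ} {f f' f'' : ℝ → ℝ} {r : ℝ}
    (hf : HasDerivAt f (f' r) r) (hf' : HasDerivAt f' (f'' r) r) (hr : r ≠ 0)
    (h0 : f r ≠ 0) (a b c : Idx D) :
    HasDerivAt (christoffelRadial f f' a b c) (christoffelRadialDeriv f f' f'' a b c r) r := by
  have h1 : HasDerivAt (fun r => f' r / (2 * f r))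
      ((f'' r * f r - f' r ^ 2) / (2 * f r ^ 2)) r := by
    refine (hf'.fun_div (hf.const_mul 2) (by simpa using h0)).congr_deriv ?_
    field_simp
  have h2 : HasDerivAt (fun r : ℝ => 1 / r) (-1 / r ^ 2) r := by
    simpa [neg_div] using hasDerivAt_inv hr
  induction a using Idx.cases <;> induction b using Idx.cases <;>
    induction c using Idx.cases <;> unfold christoffelRadial christoffelRadialDeriv
  any_goals exact hasDerivAt_const _ _
  any_goals exact h1
  any_goals exact h2
  · exact ((hf.mul hf').div_const 2).congr_deriv
      (show _ = (f' r ^ 2 + f r * f'' r) / 2 by ring)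
  · simp only [neg_div]
    exact h1.neg
  · exact (hf.fun_neg.fun_mul (hasDerivAt_id' r)).congr_deriv
      (show _ = -f' r * r - f r by ring)

theorem christoffel_of_diagonal {ι : Type} [Fintype ι] [DecidableEq ι]
    {g : (ι → ℝ) → Matrix ι ι ℝ} {x : ι → ℝ} {h : ι → ℝ} (hg : g x = Matrix.diagonal h)
    (hh : ∀ a, h a ≠ 0) (a b c : ι) :
    christoffel g a b c x = 1 / (2 * h a) * (pderiv b (fun y => g y a c) x
      + pderiv c (fun y => g y a b) x - pderiv a (fun y => g y b c) x) := by
  rw [christoffel, hg]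
  simp only [inv_diagonal_apply h hh, ite_mul, zero_mul, Finset.sum_ite_eq, Finset.mem_univ,
    if_true]
  have := hh a
  field_simp

variable {D : ℕ} {m : ℝ → ℝ}

theorem pderiv_const {ι : Type} [Fintype ι] [DecidableEq ι] (i : ι) (c : ℝ) (x : ι → ℝ) :
    pderiv i (fun _ => c) x = 0 := by
  simp [pderiv]

theorem pderiv_metricAngular_inl (i j : Fin 2) (k : Fin (D - 2)) (u : Fin (D - 2) → ℝ) :
    pderiv k (metricAngular (Sum.inl i) (Sum.inl j)) u = 0 :=
  pderiv_const k 1 u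

theorem pderiv_metricAngular_inr (i j k : Fin (D - 2)) (u : Fin (D - 2) → ℝ) :
    pderiv k (metricAngular (Sum.inr i) (Sum.inr j)) u
      = -4 * u k / (1 + ∑ j, u j ^ 2) * conformalFactor u * if i = j then 1 else 0 := by
  have : metricAngular (Sum.inr i) (Sum.inr j)
      = fun u : Fin (D - 2) → ℝ => conformalFactor u * if i = j then 1 else 0 := rfl
  rw [this, pderiv_mul (differentiableAt_conformalFactor u) (differentiableAt_const _),
    pderiv_conformalFactor]
  simp [pderiv]

theorem christoffel_metric {f' : ℝ → ℝ} {x : Idx D → ℝ} (hr : 0 < x (Sum.inl 1))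
    (hf : HasDerivAt (lapse D m) (f' (x (Sum.inl 1))) (x (Sum.inl 1)))
    (h0 : lapse D m (x (Sum.inl 1)) ≠ 0) (a b c : Idx D) :
    christoffel (metric D m) a b c x
      = christoffelRadial (lapse D m) f' a b c (x (Sum.inl 1))
        * christoffelAngular a b c fun i => x (Sum.inr i) := by
  rw [christoffel_of_diagonal (metric_eq_diagonal D m x) (metricDiag_ne_zero hr h0)]
  have hd : ∀ a b e, pderiv e (fun y => metric D m y a b) x = separatedDeriv
      (metricRadial (lapse D m) a b) (metricRadialDeriv (lapse D m) f' a b)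
      (metricAngular a b) x e := by
    intro a b e
    rw [metric_eq_separated]
    exact pderiv_separated (hasDerivAt_metricRadial hf h0 a b)
      (differentiableAt_metricAngular a b _) e
  have hφ := (conformalFactor_pos fun i => x (Sum.inr i)).ne'
  have hN := (one_add_sum_sq_pos fun i => x (Sum.inr i)).ne'
  have hr' := hr.ne'
  simp only [hd]
  induction a using Idx.cases <;> induction b using Idx.cases <;>
    induction c using Idx.cases <;>
    simp [separatedDeriv, metricRadial, metricRadialDeriv, metricAngular, metricDiag,
      christoffelRadial, christoffelAngular, pderiv_metricAngular_inl, pderiv_metricAngular_inr,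
      sphereChristoffel]
  all_goals
    try split_ifs
    all_goals field_simp
    all_goals try ring

end

/-! ### The Riemann tensor of the black-hole metric. -/

section

variable {D : ℕ} {m : ℝ → ℝ}

/-- The sectional curvatures of a metric `-f dt² + f⁻¹ dr² + r² dΩ²`, in terms of
`f`, `f'` and `f''`. -/
def sectional {D : ℕ} (f f' f'' : ℝ → ℝ) (r : ℝ) : Idx D → Idx D → ℝ
  | Sum.inl _, Sum.inl _ => -f'' r / 2
  | Sum.inr _, Sum.inr _ => (1 - f r) / r ^ 2
  | _, _ => -f' r / (2 * r)

theorem pderiv_christoffelAngular_inl (i j k : Fin 2) (l : Fin (D - 2)) (u : Fin (D - 2) → ℝ) :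
    pderiv l (christoffelAngular (Sum.inl i) (Sum.inl j) (Sum.inl k)) u = 0 :=
  pderiv_const l 1 u

theorem pderiv_christoffelAngular_mid (i k : Fin (D - 2)) (l : Fin (D - 2))
    (u : Fin (D - 2) → ℝ) :
    pderiv l (christoffelAngular (Sum.inr i) (Sum.inl 1) (Sum.inr k)) u = 0 :=
  pderiv_const l _ u

theorem pderiv_christoffelAngular_right (i k : Fin (D - 2)) (l : Fin (D - 2))
    (u : Fin (D - 2) → ℝ) :
    pderiv l (christoffelAngular (Sum.inr i) (Sum.inr k) (Sum.inl 1)) u = 0 :=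
  pderiv_const l _ u

theorem pderiv_christoffelAngular_radial (i j k : Fin (D - 2)) (u : Fin (D - 2) → ℝ) :
    pderiv k (christoffelAngular (Sum.inl 1) (Sum.inr i) (Sum.inr j)) u
      = -4 * u k / (1 + ∑ j, u j ^ 2) * conformalFactor u * if i = j then 1 else 0 :=
  pderiv_metricAngular_inr i j k u

theorem pderiv_christoffelAngular_inr (i j k l : Fin (D - 2)) (u : Fin (D - 2) → ℝ) :
    pderiv l (christoffelAngular (Sum.inr i) (Sum.inr j) (Sum.inr k)) u
      = pderiv l (sphereChristoffel i j k) u := rfl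

theorem riemannUp_antisymm {ι : Type} [Fintype ι] [DecidableEq ι]
    (g : (ι → ℝ) → Matrix ι ι ℝ) (x : ι → ℝ) (a b c d : ι) :
    riemannUp g x a b c d = -riemannUp g x a b d c := by
  simp only [riemannUp, Finset.sum_sub_distrib]
  ring

theorem riemannUp_metric_expand {f' f'' : ℝ → ℝ} {x : Idx D → ℝ} (hr : 0 < x (Sum.inl 1))
    (hf : ∀ r, 0 < r → HasDerivAt (lapse D m) (f' r) r)
    (hf' : ∀ r, 0 < r → HasDerivAt f' (f'' r) r)
    (h0 : lapse D m (x (Sum.inl 1)) ≠ 0) (a b c d : Idx D) :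
    riemannUp (metric D m) x a b c d
      = separatedDeriv (christoffelRadial (lapse D m) f' a d b)
          (christoffelRadialDeriv (lapse D m) f' f'' a d b) (christoffelAngular a d b) x c
        - separatedDeriv (christoffelRadial (lapse D m) f' a c b)
          (christoffelRadialDeriv (lapse D m) f' f'' a c b) (christoffelAngular a c b) x d
        + ∑ e, (christoffelRadial (lapse D m) f' a c e (x (Sum.inl 1))
              * (christoffelAngular a c e fun i => x (Sum.inr i))
              * (christoffelRadial (lapse D m) f' e d b (x (Sum.inl 1))
              * christoffelAngular e d b fun i => x (Sum.inr i))
            - christoffelRadial (lapse D m) f' a d e (x (Sum.inl 1))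
              * (christoffelAngular a d e fun i => x (Sum.inr i))
              * (christoffelRadial (lapse D m) f' e c b (x (Sum.inl 1))
              * christoffelAngular e c b fun i => x (Sum.inr i))) := by
  have hΓ : ∀ a b c, christoffel (metric D m) a b c x
      = christoffelRadial (lapse D m) f' a b c (x (Sum.inl 1))
        * christoffelAngular a b c fun i => x (Sum.inr i) :=
    christoffel_metric hr (hf _ hr) h0
  have hd : ∀ a b c e, pderiv e (christoffel (metric D m) a b c) x = separatedDeriv
      (christoffelRadial (lapse D m) f' a b c) (christoffelRadialDeriv (lapse D m) f' f'' a b c)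
      (christoffelAngular a b c) x e := by
    intro a b c e
    -- The closed form of the symbols needs `r > 0` and `f ≠ 0`. Both conditions are open, so it
    -- holds near `x` and may be differentiated.
    have hev : christoffel (metric D m) a b c =ᶠ[𝓝 x] fun y =>
        christoffelRadial (lapse D m) f' a b c (y (Sum.inl 1))
          * christoffelAngular a b c fun i => y (Sum.inr i) := by
      have hc : ContinuousAt (fun y : Idx D → ℝ => y (Sum.inl 1)) x :=
        (continuous_apply _).continuousAt
      have h1 : ∀ᶠ y in 𝓝 x, 0 < y (Sum.inl 1) := hc.eventually (lt_mem_nhds hr)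
      have h2 : ∀ᶠ y in 𝓝 x, lapse D m (y (Sum.inl 1)) ≠ 0 :=
        hc.eventually ((hf _ hr).continuousAt.eventually_ne h0)
      filter_upwards [h1, h2] with y h1 h2
      exact christoffel_metric h1 (hf _ h1) h2 a b c
    rw [pderiv, hev.fderiv_eq]
    exact pderiv_separated (hasDerivAt_christoffelRadial (hf _ hr) (hf' _ hr) hr.ne' h0 a b c)
      (differentiableAt_christoffelAngular a b c _) e
  simp only [riemannUp, hΓ, hd]

theorem riemannUp_metric_tr {f' f'' : ℝ → ℝ} {x : Idx D → ℝ} (hr : 0 < x (Sum.inl 1))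
    (hf : ∀ r, 0 < r → HasDerivAt (lapse D m) (f' r) r)
    (hf' : ∀ r, 0 < r → HasDerivAt f' (f'' r) r)
    (h0 : lapse D m (x (Sum.inl 1)) ≠ 0) (a b : Idx D) :
    riemannUp (metric D m) x a b (Sum.inl 0) (Sum.inl 1)
      = sectional (lapse D m) f' f'' (x (Sum.inl 1)) a b
        * ((if a = (Sum.inl 0) then 1 else 0) * metric D m x b (Sum.inl 1)
          - (if a = (Sum.inl 1) then 1 else 0) * metric D m x b (Sum.inl 0)) := by
  rw [riemannUp_metric_expand hr hf hf' h0, metric_eq_diagonal, Idx.sum_univ]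
  induction a using Idx.cases <;> induction b using Idx.cases <;>
    simp [separatedDeriv, christoffelRadial, christoffelRadialDeriv, christoffelAngular,
      metricDiag, sectional]
  all_goals
    field_simp
    ring

theorem riemannUp_metric_tu {f' f'' : ℝ → ℝ} {x : Idx D → ℝ} (hr : 0 < x (Sum.inl 1))
    (hf : ∀ r, 0 < r → HasDerivAt (lapse D m) (f' r) r)
    (hf' : ∀ r, 0 < r → HasDerivAt f' (f'' r) r)
    (h0 : lapse D m (x (Sum.inl 1)) ≠ 0) (a b : Idx D) (k : Fin (D - 2)) :
    riemannUp (metric D m) x a b (Sum.inl 0) (Sum.inr k)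
      = sectional (lapse D m) f' f'' (x (Sum.inl 1)) a b
        * ((if a = (Sum.inl 0) then 1 else 0) * metric D m x b (Sum.inr k)
          - (if a = (Sum.inr k) then 1 else 0) * metric D m x b (Sum.inl 0)) := by
  rw [riemannUp_metric_expand hr hf hf' h0, metric_eq_diagonal, Idx.sum_univ]
  have hr' := hr.ne'
  induction a using Idx.cases <;> induction b using Idx.cases <;>
    simp [separatedDeriv, christoffelRadial, christoffelAngular, metricDiag, sectional,
      Matrix.diagonal_apply, pderiv_christoffelAngular_inl]
  all_goals
    split_ifs <;> subst_vars <;> first | contradiction | (field_simp; done) | (field_simp; ring)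

theorem riemannUp_metric_ru {f' f'' : ℝ → ℝ} {x : Idx D → ℝ} (hr : 0 < x (Sum.inl 1))
    (hf : ∀ r, 0 < r → HasDerivAt (lapse D m) (f' r) r)
    (hf' : ∀ r, 0 < r → HasDerivAt f' (f'' r) r)
    (h0 : lapse D m (x (Sum.inl 1)) ≠ 0) (a b : Idx D) (k : Fin (D - 2)) :
    riemannUp (metric D m) x a b (Sum.inl 1) (Sum.inr k)
      = sectional (lapse D m) f' f'' (x (Sum.inl 1)) a b
        * ((if a = (Sum.inl 1) then 1 else 0) * metric D m x b (Sum.inr k)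
          - (if a = (Sum.inr k) then 1 else 0) * metric D m x b (Sum.inl 1)) := by
  rw [riemannUp_metric_expand hr hf hf' h0, metric_eq_diagonal, Idx.sum_univ]
  have hr' := hr.ne'
  induction a using Idx.cases <;> induction b using Idx.cases <;>
    simp [separatedDeriv, christoffelRadial, christoffelRadialDeriv, christoffelAngular,
      metricDiag, sectional, Matrix.diagonal_apply, pderiv_christoffelAngular_inl,
      pderiv_christoffelAngular_mid]
  case u.u => ring
  all_goals
    split_ifs <;> subst_vars <;> first | contradiction | (field_simp; done) | (field_simp; ring)

theorem riemannUp_metric_uu {f' f'' : ℝ → ℝ} {x : Idx D → ℝ} (hr : 0 < x (Sum.inl 1))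
    (hf : ∀ r, 0 < r → HasDerivAt (lapse D m) (f' r) r)
    (hf' : ∀ r, 0 < r → HasDerivAt f' (f'' r) r)
    (h0 : lapse D m (x (Sum.inl 1)) ≠ 0) (a b : Idx D) (k l : Fin (D - 2)) :
    riemannUp (metric D m) x a b (Sum.inr k) (Sum.inr l)
      = sectional (lapse D m) f' f'' (x (Sum.inl 1)) a b
        * ((if a = (Sum.inr k) then 1 else 0) * metric D m x b (Sum.inr l)
          - (if a = (Sum.inr l) then 1 else 0) * metric D m x b (Sum.inr k)) := by
  rw [riemannUp_metric_expand hr hf hf' h0, metric_eq_diagonal, Idx.sum_univ]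
  have hφ := (conformalFactor_pos fun i => x (Sum.inr i)).ne'
  have hN := (one_add_sum_sq_pos fun i => x (Sum.inr i)).ne'
  have hr' := hr.ne'
  induction a using Idx.cases <;> induction b using Idx.cases <;>
    simp [separatedDeriv, christoffelRadial, christoffelAngular, metricDiag, sectional,
      Matrix.diagonal_apply, pderiv_christoffelAngular_right,
      pderiv_christoffelAngular_radial, pderiv_christoffelAngular_inr]
  case r.r =>
    simp only [eq_comm (a := l) (b := k)]
    ring
  case r.u i =>
    simp only [sphereChristoffel, eq_comm (a := l) (b := k)]
    split_ifs <;> subst_vars <;> first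
      | contradiction
      | (simp; done)
      | (field_simp; done)
      | (field_simp; ring)
  case u.r i =>
    simp only [sphereChristoffel, eq_comm (a := l) (b := k)]
    ring
  case u.u i j =>
    rw [← Finset.sum_sub_distrib]
    -- The intrinsic curvature of the sphere gives the `1` in `1 - f`; the `-f` comes from the
    -- products of `1/r` with `-f r` at the summation index `r`.
    have h := sphere_curvature i j k l fun i => x (Sum.inr i)
    rw [← add_assoc, add_right_comm, h]
    simp only [eq_comm (a := l) (b := j), eq_comm (a := k) (b := j)]
    split_ifs <;> subst_vars <;> first
      | contradiction
      | (simp; done)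
      | (field_simp; done)
      | (field_simp; ring)

/-- Antisymmetry in the last two indices leaves only the pairs `tr`, `tu`, `ru` and `uu`. -/
theorem riemannUp_metric {f' f'' : ℝ → ℝ} {x : Idx D → ℝ} (hr : 0 < x (Sum.inl 1))
    (hf : ∀ r, 0 < r → HasDerivAt (lapse D m) (f' r) r)
    (hf' : ∀ r, 0 < r → HasDerivAt f' (f'' r) r)
    (h0 : lapse D m (x (Sum.inl 1)) ≠ 0) (a b c d : Idx D) :
    riemannUp (metric D m) x a b c d
      = sectional (lapse D m) f' f'' (x (Sum.inl 1)) a b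
        * ((if a = c then 1 else 0) * metric D m x b d
          - (if a = d then 1 else 0) * metric D m x b c) := by
  have hdiag : ∀ c, riemannUp (metric D m) x a b c c = 0 := by
    intro c
    have := riemannUp_antisymm (metric D m) x a b c c
    linarith
  induction c using Idx.cases <;> induction d using Idx.cases
  · rw [hdiag]; ring
  · exact riemannUp_metric_tr hr hf hf' h0 a b
  · exact riemannUp_metric_tu hr hf hf' h0 a b _
  · rw [riemannUp_antisymm, riemannUp_metric_tr hr hf hf' h0 a b]; ring
  · rw [hdiag]; ring
  · exact riemannUp_metric_ru hr hf hf' h0 a b _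
  · rw [riemannUp_antisymm, riemannUp_metric_tu hr hf hf' h0 a b]; ring
  · rw [riemannUp_antisymm, riemannUp_metric_ru hr hf hf' h0 a b]; ring
  · exact riemannUp_metric_uu hr hf hf' h0 a b _ _

end

/-! ### The Weyl tensor, the doubling tensor and the conjugate field. -/

section

/-- The sectional components of the spherically symmetric trace-free Weyl-type tensor,
normalised to be `1` on the `(t, r)` plane. -/
def traceFreeProfile (D : ℕ) : Idx D → Idx D → ℝ
  | Sum.inl _, Sum.inl _ => 1
  | Sum.inr _, Sum.inr _ => 2 / (((D : ℝ) - 2) * ((D : ℝ) - 3))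
  | _, _ => -1 / ((D : ℝ) - 2)

theorem card_idx {D : ℕ} (hD : 4 ≤ D) : (Fintype.card (Idx D) : ℝ) = D := by
  have : Fintype.card (Idx D) = D := by
    simp only [Fintype.card_sum, Fintype.card_fin]
    omega
  rw [this]

theorem cast_sub_two {D : ℕ} (hD : 4 ≤ D) : ((D - 2 : ℕ) : ℝ) = (D : ℝ) - 2 := by
  rw [Nat.cast_sub (by omega)]
  norm_num

/-- Trace-freeness fixes the profile: `1 + (D-2)·(-1/(D-2)) = 0` along `t` or `r`, and `2·(-1/(D-2))
+ (D-3)·2/((D-2)(D-3)) = 0` along an angle. Both sides depend only on the blocks of `a` and `b`, so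
`a = b` needs no exception. -/
theorem weylSectional_sectional {D : ℕ} (hD : 4 ≤ D) (f f' f'' : ℝ → ℝ) (r : ℝ) (a b : Idx D) :
    weylSectional (sectional f f' f'' r) a b
      = ((D : ℝ) - 3) / ((D : ℝ) - 1) * (-f'' r / 2 + f' r / r + (1 - f r) / r ^ 2)
        * traceFreeProfile D a b := by
  have hl : ∀ i : Fin 2, ricciEigenvalue (sectional f f' f'' r : Idx D → Idx D → ℝ) (Sum.inl i)
      = -f'' r / 2 + ((D : ℝ) - 2) * (-f' r / (2 * r)) := by
    intro i
    simp only [ricciEigenvalue, Idx.sum_univ, sectional, Finset.sum_const, Finset.card_univ,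
      Fintype.card_fin, nsmul_eq_mul, cast_sub_two hD]
    ring
  have hu : ∀ i, ricciEigenvalue (sectional f f' f'' r : Idx D → Idx D → ℝ) (Sum.inr i)
      = 2 * (-f' r / (2 * r)) + ((D : ℝ) - 3) * ((1 - f r) / r ^ 2) := by
    intro i
    simp only [ricciEigenvalue, Idx.sum_univ, sectional, Finset.sum_const, Finset.card_univ,
      Fintype.card_fin, nsmul_eq_mul, cast_sub_two hD]
    ring
  have hD' : (4 : ℝ) ≤ D := by exact_mod_cast hD
  have h1 : (D : ℝ) - 1 ≠ 0 := by linarith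
  have h2 : (D : ℝ) - 2 ≠ 0 := by linarith
  have h3 : (D : ℝ) - 3 ≠ 0 := by linarith
  have hk : f' r / r = -2 * (-f' r / (2 * r)) := by ring
  rw [hk]
  rcases a with a | a <;> rcases b with b | b <;>
    simp only [weylSectional, hl, hu, Idx.sum_univ, Finset.sum_const, Finset.card_univ,
      Fintype.card_fin, nsmul_eq_mul, cast_sub_two hD, card_idx hD, sectional,
      traceFreeProfile] <;>
    generalize -f' r / (2 * r) = k <;> generalize (1 - f r) / r ^ 2 = l <;>
    field_simp <;> ring

theorem sum_traceFreeProfile_sq {D : ℕ} (hD : 4 ≤ D) :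
    ∑ a, (∑ b, traceFreeProfile D a b ^ 2 - traceFreeProfile D a a ^ 2)
      = 2 * ((D : ℝ) - 1) / ((D : ℝ) - 3) := by
  have hD' : (4 : ℝ) ≤ D := by exact_mod_cast hD
  have h2 : (D : ℝ) - 2 ≠ 0 := by linarith
  have h3 : (D : ℝ) - 3 ≠ 0 := by linarith
  simp only [Idx.sum_univ, traceFreeProfile, Finset.sum_const, Finset.card_univ,
      Fintype.card_fin, nsmul_eq_mul, cast_sub_two hD]
  field_simp
  ring

theorem inv_metric_apply {D : ℕ} {m : ℝ → ℝ} {x : Idx D → ℝ} (hr : 0 < x (Sum.inl 1))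
    (h0 : lapse D m (x (Sum.inl 1)) ≠ 0) (a b : Idx D) :
    (metric D m x)⁻¹ a b = if a = b then (metricDiag (lapse D m) x a)⁻¹ else 0 := by
  rw [metric_eq_diagonal, inv_diagonal_apply _ (metricDiag_ne_zero hr h0)]

/-- Since `g_{tt} g_{rr} = -1`, the square of the form is `-q²` times the `(t, r)` block of the
metric, whatever `f` is. -/
theorem dot1_radialForm {D : ℕ} {m : ℝ → ℝ} {x : Idx D → ℝ} (hr : 0 < x (Sum.inl 1))
    (h0 : lapse D m (x (Sum.inl 1)) ≠ 0) (q : ℝ) (a b : Idx D) :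
    dot1 (metric D m x) (radialForm D q) a b
      = Sum.elim (fun _ => -q ^ 2) (fun _ => 0) b * metric D m x a b := by
  simp only [dot1, inv_metric_apply hr h0, ite_mul, zero_mul, Finset.sum_ite_eq,
    Finset.mem_univ, if_true, Idx.sum_univ]
  rw [metric_eq_diagonal]
  induction a using Idx.cases <;> induction b using Idx.cases <;>
    simp [radialForm, metricDiag, Matrix.diagonal_apply] <;> field_simp

theorem dot2_radialForm {D : ℕ} {m : ℝ → ℝ} {x : Idx D → ℝ} (hr : 0 < x (Sum.inl 1))
    (h0 : lapse D m (x (Sum.inl 1)) ≠ 0) (q : ℝ) :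
    dot2 (metric D m x) (radialForm D q) = -2 * q ^ 2 := by
  simp only [dot2, dot1_radialForm hr h0, inv_metric_apply hr h0, ite_mul, zero_mul,
    Finset.sum_ite_eq, Finset.mem_univ, if_true, Idx.sum_univ]
  rw [metric_eq_diagonal]
  simp [metricDiag]
  field_simp
  ring

/-- On the `(t, r)` plane the first product contributes `q²` and the antisymmetrised second one
`q²/2`; dividing by `g_{tt} g_{rr} = -1` gives `-3/2 q²`. -/
theorem antisymPairs_radialForm {D : ℕ} {m : ℝ → ℝ} {x : Idx D → ℝ}
    (h0 : lapse D m (x (Sum.inl 1)) ≠ 0) (q : ℝ) (a b c d : Idx D) :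
    antisymPairs (fun a b c d => radialForm D q a b * radialForm D q c d
        - radialForm D q c a * radialForm D q b d) a b c d
      = Sum.elim (fun _ => Sum.elim (fun _ => -(3 / 2) * q ^ 2) (fun _ => 0) b) (fun _ => 0) a
        * (metric D m x a c * metric D m x b d - metric D m x a d * metric D m x b c) := by
  rw [metric_eq_diagonal]
  have hz : ∀ (a : Idx D) i, radialForm D q a (Sum.inr i) = 0 := by
    intro a i
    rcases a with a | a <;> simp [radialForm]
  have hz' : ∀ (a : Idx D) i, radialForm D q (Sum.inr i) a = 0 := by
    intro a i
    rcases a with a | a <;> simp [radialForm]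
  rcases a with a | a <;> rcases b with b | b <;> rcases c with c | c <;> rcases d with d | d <;>
    simp only [antisymPairs, hz, hz', Sum.elim_inl, Sum.elim_inr, Matrix.diagonal_apply,
      reduceCtorEq, if_false, mul_zero, zero_mul, sub_zero, add_zero]
  fin_cases a <;> fin_cases b <;> fin_cases c <;> fin_cases d <;>
    simp [radialForm, metricDiag, h0] <;> ring

theorem doubling_radialForm {D : ℕ} (hD : 4 ≤ D) {m : ℝ → ℝ} {x : Idx D → ℝ}
    (hr : 0 < x (Sum.inl 1)) (h0 : lapse D m (x (Sum.inl 1)) ≠ 0) (q : ℝ) (a b c d : Idx D) :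
    doubling (metric D m x) (radialForm D q) a b c d
      = -(3 / 2) * q ^ 2 * (((D : ℝ) - 3) / ((D : ℝ) - 1)) * traceFreeProfile D a b
        * (metric D m x a c * metric D m x b d - metric D m x a d * metric D m x b c) := by
  -- For a tensor with eigenvalues `μ`, antisymmetrising `g_{ac} μ_b g_{bd}` yields `(μ_a + μ_b)/4`
  -- times `g_{ac} g_{bd} - g_{ad} g_{bc}`, so the metric terms are sectional too.
  have hsplit : doubling (metric D m x) (radialForm D q) a b c d
      = antisymPairs (fun a b c d => radialForm D q a b * radialForm D q c d
        - radialForm D q c a * radialForm D q b d) a b c d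
        + (-(6 / ((D : ℝ) - 2)) * (Sum.elim (fun _ => -q ^ 2) (fun _ => 0) a
            + Sum.elim (fun _ => -q ^ 2) (fun _ => 0) b) / 4
          - 3 / (((D : ℝ) - 1) * ((D : ℝ) - 2)) * q ^ 2)
        * (metric D m x a c * metric D m x b d - metric D m x a d * metric D m x b c) := by
    have hdot : ∀ b d, dot1 (metric D m x) (radialForm D q) b d
        = Sum.elim (fun _ => -q ^ 2) (fun _ => 0) b * metric D m x b d := by
      intro b d
      rw [dot1_radialForm hr h0, metric_eq_diagonal]
      by_cases h : b = d
      · rw [h]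
      · simp [h]
    simp only [doubling, antisymPairs, hdot, dot2_radialForm hr h0, card_idx hD]
    ring
  rw [hsplit, antisymPairs_radialForm h0, ← add_mul]
  congr 1
  have hD' : (4 : ℝ) ≤ D := by exact_mod_cast hD
  have h1 : (D : ℝ) - 1 ≠ 0 := by linarith
  have h2 : (D : ℝ) - 2 ≠ 0 := by linarith
  have h3 : (D : ℝ) - 3 ≠ 0 := by linarith
  rcases a with a | a <;> rcases b with b | b <;>
    simp only [Sum.elim_inl, Sum.elim_inr, traceFreeProfile] <;> field_simp <;> ring

/-! The Born-Infeld determinant. -/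

theorem det_smul_off_diagonal_symm {ι : Type} [Fintype ι] [DecidableEq ι] (M : Matrix ι ι ℝ)
    (σ : ι → ℝ) (hσ : ∀ a, σ a * σ a = 1) :
    (Matrix.of fun a b => σ a * M a b * σ b).det = M.det := by
  have : (Matrix.of fun a b => σ a * M a b * σ b)
      = Matrix.diagonal σ * M * Matrix.diagonal σ := by
    ext a b
    simp [Matrix.mul_diagonal, Matrix.diagonal_mul]
  rw [this, Matrix.det_mul, Matrix.det_mul, mul_right_comm, ← Matrix.det_mul,
    Matrix.diagonal_mul_diagonal]
  simp [hσ]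

/-- No differentiability is needed: `deriv_comp_neg` holds also for the default value of `deriv`.
Smoothness of the Lagrangian in the angular directions thus never has to be proved. -/
theorem deriv_even {F : ℝ → ℝ} (hF : ∀ s, F (-s) = F s) : deriv F 0 = 0 := by
  have h := deriv_comp_neg F 0
  simp only [hF, neg_zero] at h
  linarith

/-- The reflection `u_i ↦ -u_i` of the components fixes `g` and the radial form. When `a ≠ b`
exactly one of them is `u_i`, so it reverses the variation and the determinant is even in `s`. -/
theorem dLagrangian_eq_zero {D : ℕ} (lam : ℝ) (m : ℝ → ℝ) (x : Idx D → ℝ) (E : ℝ) (a b : Idx D)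
    (hab : a = b ∨ ∃ i, a = Sum.inr i ∨ b = Sum.inr i) :
    dLagrangian lam (metric D m) x (radialForm D E) a b = 0 := by
  by_cases heq : a = b
  · simp [dLagrangian, heq]
  obtain ⟨i, hi⟩ := hab.resolve_left heq
  rw [dLagrangian, deriv_even, mul_zero]
  intro s
  have hdet : (metric D m x + lam • (radialForm D E
        + (-s) • (Matrix.single a b (1 : ℝ) - Matrix.single b a (1 : ℝ)))).det
      = (metric D m x + lam • (radialForm D E
        + s • (Matrix.single a b (1 : ℝ) - Matrix.single b a (1 : ℝ)))).det := by
    rw [← det_smul_off_diagonal_symm _ (fun c => if c = Sum.inr i then -1 else 1)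
      (fun c => by split_ifs <;> norm_num)]
    congr 1
    ext c d
    let σ : Idx D → ℝ := fun c => if c = Sum.inr i then -1 else 1
    have hg : σ c * metric D m x c d * σ d = metric D m x c d := by
      rw [metric_eq_diagonal]
      by_cases h : c = d
      · subst h
        simp only [σ]
        split_ifs <;> simp
      · simp [h]
    have hF : σ c * radialForm D E c d * σ d = radialForm D E c d := by
      rcases c with c | c <;> rcases d with d | d <;> simp [radialForm, σ]
    have hX : σ c * (Matrix.single a b (1 : ℝ) c d - Matrix.single b a (1 : ℝ) c d) * σ d
        = -(Matrix.single a b (1 : ℝ) c d - Matrix.single b a (1 : ℝ) c d) := by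
      simp only [Matrix.single_apply, σ]
      grind
    simp only [Matrix.of_apply, Matrix.add_apply, Matrix.smul_apply, Matrix.sub_apply,
      smul_eq_mul]
    linear_combination hg + lam * hF - lam * s * hX
  simp only [lagrangian, hdet]

theorem det_metric_add {D : ℕ} {lam : ℝ} {m : ℝ → ℝ} {x : Idx D → ℝ}
    (h0 : lapse D m (x (Sum.inl 1)) ≠ 0) (E : ℝ) :
    (metric D m x + lam • radialForm D E).det
      = (-1 + lam ^ 2 * E ^ 2) * (x (Sum.inl 1) ^ 2 • sphereMetric fun i => x (Sum.inr i)).det := by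
  rw [metric, radialForm, Matrix.fromBlocks_smul, Matrix.fromBlocks_add]
  simp only [smul_zero, add_zero, Matrix.det_fromBlocks_zero₂₁, Matrix.det_fin_two]
  simp [h0]
  left
  ring

theorem radialForm_add_single {D : ℕ} (E s : ℝ) :
    radialForm D E + s • (Matrix.single (Sum.inl 0) (Sum.inl 1) (1 : ℝ)
      - Matrix.single (Sum.inl 1) (Sum.inl 0) (1 : ℝ)) = radialForm D (E + s) := by
  ext a b
  induction a using Idx.cases <;> induction b using Idx.cases <;>
    simp [radialForm]
  ring

theorem det_sphere_pos {D : ℕ} {x : Idx D → ℝ} (hr : 0 < x (Sum.inl 1)) :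
    0 < (x (Sum.inl 1) ^ 2 • sphereMetric fun i => x (Sum.inr i)).det := by
  have h := one_add_sum_sq_pos fun i => x (Sum.inr i)
  rw [sphereMetric_eq, smul_smul, Matrix.det_smul]
  simp only [Matrix.det_one, mul_one]
  positivity

/-- The variation merely replaces `E` by `E + s`. The bound `λ²E² < 1` keeps the determinant away
from zero, where the absolute value and the root are not smooth. -/
theorem dLagrangian_tr {D : ℕ} {lam : ℝ} (hlam : lam ≠ 0) {m : ℝ → ℝ} {x : Idx D → ℝ}
    (hr : 0 < x (Sum.inl 1)) (h0 : lapse D m (x (Sum.inl 1)) ≠ 0) {E : ℝ}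
    (hE : lam ^ 2 * E ^ 2 < 1) :
    dLagrangian lam (metric D m) x (radialForm D E) (Sum.inl 0) (Sum.inl 1)
      = 1 / 2 * (√|(metric D m x).det| * (E / √(1 - lam ^ 2 * E ^ 2))) := by
  have hpos := det_sphere_pos hr
  have hg : |(metric D m x).det|
      = (x (Sum.inl 1) ^ 2 • sphereMetric fun i => x (Sum.inr i)).det := by
    -- The case `E = 0` identifies `|det g|` with the determinant of the angular block.
    have h := det_metric_add (lam := lam) h0 0
    have hz : radialForm D 0 = 0 := by
      ext a b
      induction a using Idx.cases <;> induction b using Idx.cases <;> simp [radialForm]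
    rw [hz, smul_zero, add_zero] at h
    rw [h, abs_mul, abs_of_pos hpos]
    norm_num
  have hP : 0 < 1 - lam ^ 2 * E ^ 2 := by linarith
  rw [dLagrangian]
  congr 1
  have h1 : HasDerivAt (fun s : ℝ => -1 + lam ^ 2 * (E + s) ^ 2) (lam ^ 2 * (2 * E)) 0 := by
    have := ((((hasDerivAt_id' (0 : ℝ)).const_add E).fun_pow 2).const_mul (lam ^ 2)).const_add (-1)
    refine this.congr_deriv ?_
    simp
  have h2 : HasDerivAt (fun s : ℝ => √|-1 + lam ^ 2 * (E + s) ^ 2|)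
      (-(lam ^ 2 * E) / √(1 - lam ^ 2 * E ^ 2)) 0 := by
    have hneg : -1 + lam ^ 2 * (E + 0) ^ 2 < 0 := by
      rw [add_zero]
      linarith
    have ha := HasDerivAt.comp (h₂ := fun y : ℝ => |y|) (0 : ℝ) (hasDerivAt_abs_neg hneg) h1
    have hs := HasDerivAt.sqrt ha (by simpa using hneg.ne)
    refine hs.congr_deriv ?_
    have : |-1 + lam ^ 2 * (E + 0) ^ 2| = 1 - lam ^ 2 * E ^ 2 := by
      rw [abs_of_neg hneg]
      ring
    simp only [Function.comp_apply, this]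
    field_simp
  have h3 : (fun s : ℝ => lagrangian lam (metric D m) x (radialForm D E
      + s • (Matrix.single (Sum.inl 0) (Sum.inl 1) (1 : ℝ)
        - Matrix.single (Sum.inl 1) (Sum.inl 0) (1 : ℝ))))
      = fun s : ℝ => √|(metric D m x).det| * scalarCurvature (metric D m) x
        + 1 / lam ^ 2 * (√|(metric D m x).det|
          - √|-1 + lam ^ 2 * (E + s) ^ 2| * √|(metric D m x).det|) := by
    funext s
    rw [radialForm_add_single, lagrangian, det_metric_add h0, abs_mul,
      Real.sqrt_mul (abs_nonneg _), abs_of_pos hpos, hg]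
  rw [h3, ((((h2.mul_const _).const_sub _).const_mul _).const_add _).deriv]
  field_simp

theorem dLagrangian_antisymm {ι : Type} [Fintype ι] [DecidableEq ι] (lam : ℝ)
    (g : (ι → ℝ) → Matrix ι ι ℝ) (x : ι → ℝ) (F : Matrix ι ι ℝ) (a b : ι) :
    dLagrangian lam g x F b a = -dLagrangian lam g x F a b := by
  have h := deriv_comp_neg (fun s : ℝ => lagrangian lam g x
    (F + s • (Matrix.single a b (1 : ℝ) - Matrix.single b a (1 : ℝ)))) 0
  have h' : ∀ s : ℝ, -s • (Matrix.single a b (1 : ℝ) - Matrix.single b a (1 : ℝ))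
      = s • (Matrix.single b a (1 : ℝ) - Matrix.single a b (1 : ℝ)) := by
    intro s
    rw [neg_smul, ← smul_neg, neg_sub]
  simp only [h', neg_zero] at h
  rw [dLagrangian, dLagrangian, h]
  ring

theorem conjugateField_radialForm {D : ℕ} {lam : ℝ} (hlam : lam ≠ 0) {m : ℝ → ℝ} {x : Idx D → ℝ}
    (hr : 0 < x (Sum.inl 1)) (h0 : lapse D m (x (Sum.inl 1)) ≠ 0)
    {F : (Idx D → ℝ) → Matrix (Idx D) (Idx D) ℝ} {E : ℝ} (hF : F x = radialForm D E)
    (hE : lam ^ 2 * E ^ 2 < 1) :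
    conjugateField lam (metric D m) F x = radialForm D (E / √(1 - lam ^ 2 * E ^ 2)) := by
  have hdet : √|(metric D m x).det| ≠ 0 := by
    rw [metric_eq_diagonal, Matrix.det_diagonal]
    exact (Real.sqrt_pos.2 (abs_pos.2 (Finset.prod_ne_zero_iff.2 fun a _ =>
      metricDiag_ne_zero hr h0 a))).ne'
  have hsum : ∀ a b, conjugateField lam (metric D m) F x a b
      = metricDiag (lapse D m) x a * metricDiag (lapse D m) x b
        * (-(2 / √|(metric D m x).det|) * dLagrangian lam (metric D m) x (radialForm D E) a b) := by
    intro a b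
    rw [conjugateField, hF]
    generalize dLagrangian lam (metric D m) x (radialForm D E) = T
    generalize -(2 / √|(metric D m x).det|) = k
    rw [metric_eq_diagonal]
    simp [Matrix.diagonal_apply]
  ext a b
  rw [hsum]
  induction a using Idx.cases <;> induction b using Idx.cases
  case t.r =>
    rw [dLagrangian_tr hlam hr h0 hE]
    simp [metricDiag, radialForm]
    field_simp
  case r.t =>
    rw [dLagrangian_antisymm, dLagrangian_tr hlam hr h0 hE]
    simp [metricDiag, radialForm]
    field_simp
  all_goals
    rw [dLagrangian_eq_zero _ _ _ _ _ _ (by simp)]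
    simp [radialForm]

end

/-! ### The mass function and the closed formulas in terms of it. -/

section

theorem hasDerivAt_div_pow {a : ℝ → ℝ} {a' r : ℝ} (ha : HasDerivAt a a' r) (hr : r ≠ 0) (p : ℕ) :
    HasDerivAt (fun r => a r / r ^ p) (a' / r ^ p - p * (a r / r ^ (p + 1))) r := by
  refine (ha.fun_div (hasDerivAt_pow p r) (pow_ne_zero p hr)).congr_deriv ?_
  -- The power rule has the truncated exponent `p - 1`; at `p = 0` its coefficient vanishes.
  rcases p with _ | p
  · simp
  · simp only [Nat.add_sub_cancel]
    field_simp
    ring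

/-- The derivative of the mass function. -/
def massDeriv (D : ℕ) (lam Q r : ℝ) : ℝ :=
  1 / lam ^ 2 * (√(r ^ (2 * (D - 2)) + lam ^ 2 * Q ^ 2) - r ^ (D - 2))

/-- The second derivative of the mass function. -/
def massDeriv2 (D : ℕ) (lam Q r : ℝ) : ℝ :=
  1 / lam ^ 2 * (((2 * (D - 2) : ℕ) * r ^ (2 * (D - 2) - 1))
    / (2 * √(r ^ (2 * (D - 2)) + lam ^ 2 * Q ^ 2)) - (D - 2 : ℕ) * r ^ (D - 2 - 1))

theorem radicand_pos {lam Q : ℝ} (hlam : lam ≠ 0) (hQ : Q ≠ 0) (n : ℕ) (r : ℝ) :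
    0 < r ^ (2 * n) + lam ^ 2 * Q ^ 2 := by
  have : 0 ≤ r ^ (2 * n) := by
    rw [pow_mul']
    positivity
  positivity

theorem hasDerivAt_massDeriv (D : ℕ) {lam Q : ℝ} (hlam : lam ≠ 0) (hQ : Q ≠ 0) (r : ℝ) :
    HasDerivAt (massDeriv D lam Q) (massDeriv2 D lam Q r) r := by
  have h := radicand_pos hlam hQ (D - 2) r
  exact ((((hasDerivAt_pow _ r).add_const _).sqrt h.ne').sub (hasDerivAt_pow _ r)).const_mul _

theorem continuous_massDeriv (D : ℕ) (lam Q : ℝ) : Continuous (massDeriv D lam Q) := by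
  unfold massDeriv
  fun_prop

theorem continuous_massDeriv2 (D : ℕ) {lam Q : ℝ} (hlam : lam ≠ 0) (hQ : Q ≠ 0) :
    Continuous (massDeriv2 D lam Q) := by
  have h : ∀ r : ℝ, 2 * √(r ^ (2 * (D - 2)) + lam ^ 2 * Q ^ 2) ≠ 0 := fun r => by
    have := Real.sqrt_pos.2 (radicand_pos hlam hQ (D - 2) r)
    positivity
  unfold massDeriv2
  fun_prop (disch := exact h)

/-- The equation for `m` holds only on `r > 0`, but that set is open, so `deriv m` equals the
explicit function near `r` and can be differentiated again. -/
theorem massBracket_eq {D : ℕ} {lam Q : ℝ} (hlam : lam ≠ 0) (hQ : Q ≠ 0) {m : ℝ → ℝ}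
    (hm : IsMassFunction D lam Q m) {r : ℝ} (hr : 0 < r) :
    massBracket D m r = ((D : ℝ) - 1) * ((D : ℝ) - 2) * m r
      - 2 * ((D : ℝ) - 2) * r * massDeriv D lam Q r + r ^ 2 * massDeriv2 D lam Q r := by
  have hev : deriv m =ᶠ[𝓝 r] massDeriv D lam Q := by
    filter_upwards [lt_mem_nhds hr] with s hs
    exact (hm s hs).deriv
  rw [massBracket, hev.deriv_eq, hev.self_of_nhds, (hasDerivAt_massDeriv D hlam hQ r).deriv]

/-- The derivative of the lapse. -/
def lapseDeriv (p : ℕ) (m m' : ℝ → ℝ) (r : ℝ) : ℝ :=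
  -(2 * (m' r / r ^ p - p * (m r / r ^ (p + 1))))

/-- The second derivative of the lapse. -/
def lapseDeriv2 (p : ℕ) (m m' m'' : ℝ → ℝ) (r : ℝ) : ℝ :=
  -(2 * (m'' r / r ^ p - p * (m' r / r ^ (p + 1))
    - p * (m' r / r ^ (p + 1) - (p + 1 : ℕ) * (m r / r ^ (p + 1 + 1)))))

theorem hasDerivAt_lapse {D : ℕ} {m m' : ℝ → ℝ} {r : ℝ} (hm : HasDerivAt m (m' r) r)
    (hr : r ≠ 0) : HasDerivAt (lapse D m) (lapseDeriv (D - 3) m m' r) r := by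
  have : lapse D m = fun r => 1 - 2 * (m r / r ^ (D - 3)) := by
    funext r
    rw [lapse, mul_div_assoc]
  rw [this]
  exact ((hasDerivAt_div_pow hm hr _).const_mul 2).const_sub 1

theorem hasDerivAt_lapseDeriv {p : ℕ} {m m' m'' : ℝ → ℝ} {r : ℝ} (hm : HasDerivAt m (m' r) r)
    (hm' : HasDerivAt m' (m'' r) r) (hr : r ≠ 0) :
    HasDerivAt (lapseDeriv p m m') (lapseDeriv2 p m m' m'' r) r :=
  (((hasDerivAt_div_pow hm' hr p).sub
    ((hasDerivAt_div_pow hm hr (p + 1)).const_mul (p : ℝ))).const_mul 2).fun_neg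

theorem curvature_combination {D : ℕ} (hD : 4 ≤ D) (m m' m'' : ℝ → ℝ) {r : ℝ} (hr : r ≠ 0) :
    -lapseDeriv2 (D - 3) m m' m'' r / 2 + lapseDeriv (D - 3) m m' r / r
        + (1 - lapse D m r) / r ^ 2
      = (((D : ℝ) - 1) * ((D : ℝ) - 2) * m r - 2 * ((D : ℝ) - 2) * r * m' r + r ^ 2 * m'' r)
        / r ^ (D - 1) := by
  obtain ⟨p, rfl⟩ : ∃ p, D = p + 3 := ⟨D - 3, by omega⟩
  have h1 : p + 3 - 1 = p + 2 := by omega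
  simp only [lapseDeriv, lapseDeriv2, lapse, Nat.add_sub_cancel, h1]
  push_cast
  field_simp
  ring

variable {D : ℕ} {lam Q : ℝ} {m : ℝ → ℝ}

theorem riemannUp_massFunction (hlam : lam ≠ 0) (hQ : Q ≠ 0) (hm : IsMassFunction D lam Q m)
    {x : Idx D → ℝ} (hr : 0 < x (Sum.inl 1)) (h0 : lapse D m (x (Sum.inl 1)) ≠ 0)
    (a b c d : Idx D) :
    riemannUp (metric D m) x a b c d
      = sectional (lapse D m) (lapseDeriv (D - 3) m (massDeriv D lam Q))
          (lapseDeriv2 (D - 3) m (massDeriv D lam Q) (massDeriv2 D lam Q)) (x (Sum.inl 1)) a b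
        * ((if a = c then 1 else 0) * metric D m x b d
          - (if a = d then 1 else 0) * metric D m x b c) :=
  riemannUp_metric hr (fun r hr => hasDerivAt_lapse (hm r hr) hr.ne')
    (fun r hr => hasDerivAt_lapseDeriv (hm r hr) (hasDerivAt_massDeriv D hlam hQ r) hr.ne')
    h0 a b c d

theorem weylSectional_massFunction (hD : 4 ≤ D) (hlam : lam ≠ 0) (hQ : Q ≠ 0)
    (hm : IsMassFunction D lam Q m) {r : ℝ} (hr : 0 < r) (a b : Idx D) :
    weylSectional (sectional (lapse D m) (lapseDeriv (D - 3) m (massDeriv D lam Q))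
        (lapseDeriv2 (D - 3) m (massDeriv D lam Q) (massDeriv2 D lam Q)) r) a b
      = ((D : ℝ) - 3) / ((D : ℝ) - 1) * (massBracket D m r / r ^ (D - 1))
        * traceFreeProfile D a b := by
  rw [weylSectional_sectional hD, curvature_combination hD _ _ _ hr.ne',
    massBracket_eq hlam hQ hm hr]

theorem weyl_massFunction (hD : 4 ≤ D) (hlam : lam ≠ 0) (hQ : Q ≠ 0)
    (hm : IsMassFunction D lam Q m) {x : Idx D → ℝ} (hr : 0 < x (Sum.inl 1))
    (h0 : lapse D m (x (Sum.inl 1)) ≠ 0) (a b c d : Idx D) :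
    weyl (metric D m) x a b c d
      = ((D : ℝ) - 3) / ((D : ℝ) - 1)
        * (massBracket D m (x (Sum.inl 1)) / x (Sum.inl 1) ^ (D - 1)) * traceFreeProfile D a b
        * (metric D m x a c * metric D m x b d - metric D m x a d * metric D m x b c) := by
  rw [weyl_of_sectional (metric_eq_diagonal D m x) (metricDiag_ne_zero hr h0)
    (riemannUp_massFunction hlam hQ hm hr h0), weylSectional_massFunction hD hlam hQ hm hr]

theorem weylSq_massFunction (hD : 4 ≤ D) (hlam : lam ≠ 0) (hQ : Q ≠ 0)
    (hm : IsMassFunction D lam Q m) {x : Idx D → ℝ} (hr : 0 < x (Sum.inl 1))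
    (h0 : lapse D m (x (Sum.inl 1)) ≠ 0) :
    weylSq (metric D m) x = 4 * ((D : ℝ) - 3) / (((D : ℝ) - 1) * x (Sum.inl 1) ^ (2 * (D - 1)))
      * massBracket D m (x (Sum.inl 1)) ^ 2 := by
  rw [weylSq_of_sectional (metric_eq_diagonal D m x) (metricDiag_ne_zero hr h0)
    (riemannUp_massFunction hlam hQ hm hr h0)]
  simp only [weylSectional_massFunction hD hlam hQ hm hr]
  have hD' : (4 : ℝ) ≤ D := by exact_mod_cast hD
  have h1 : (D : ℝ) - 1 ≠ 0 := by linarith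
  have h3 : (D : ℝ) - 3 ≠ 0 := by linarith
  have hr' := hr.ne'
  simp only [mul_pow _ (traceFreeProfile _ _ _), ← Finset.mul_sum, ← mul_sub,
    sum_traceFreeProfile_sq hD]
  rw [mul_comm 2 (D - 1), pow_mul]
  field_simp
  ring

/-- This shows that the field is subcritical for `r > 0`; dividing `E` by the root of the right-hand
side cancels the Born-Infeld root and leaves `Q/r^(D-2)`. -/
theorem electricField_sq (r : ℝ) (hlam : lam ≠ 0) (hQ : Q ≠ 0) :
    1 - lam ^ 2 * electricField D lam Q r ^ 2
      = r ^ (2 * (D - 2)) / (r ^ (2 * (D - 2)) + lam ^ 2 * Q ^ 2) := by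
  have h := radicand_pos hlam hQ (D - 2) r
  rw [electricField, div_pow, Real.sq_sqrt h.le]
  field_simp
  ring

theorem conjugateField_maxwell (hlam : lam ≠ 0) (hQ : Q ≠ 0) {x : Idx D → ℝ}
    (hr : 0 < x (Sum.inl 1)) (h0 : lapse D m (x (Sum.inl 1)) ≠ 0) :
    conjugateField lam (metric D m) (maxwell D lam Q) x
      = radialForm D (Q / x (Sum.inl 1) ^ (D - 2)) := by
  have h := radicand_pos hlam hQ (D - 2) (x (Sum.inl 1))
  have hsq := electricField_sq (D := D) (x (Sum.inl 1)) hlam hQ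
  rw [conjugateField_radialForm hlam hr h0 (E := electricField D lam Q (x (Sum.inl 1))) rfl, hsq,
    Real.sqrt_div' _ h.le, pow_mul', Real.sqrt_sq (by positivity), electricField, pow_mul']
  · have := Real.sqrt_pos.2 h
    rw [pow_mul'] at this
    congr 1
    field_simp
  · have : 0 < x (Sum.inl 1) ^ (2 * (D - 2)) / (x (Sum.inl 1) ^ (2 * (D - 2)) + lam ^ 2 * Q ^ 2) := by
      positivity
    linarith

/-! Behaviour at the origin. -/

/-- The right-hand side of the mass equation is continuous on all of `ℝ`, so integrating it from `1`
gives a global primitive. It has the same derivative as `m` on the connected set `r > 0`, and the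
constant is matched at `r = 1`. -/
theorem IsMassFunction.exists_extension (hm : IsMassFunction D lam Q m) :
    ∃ M : ℝ → ℝ, (∀ r, HasDerivAt M (massDeriv D lam Q r) r) ∧ ∀ r, 0 < r → m r = M r := by
  have hI : ∀ r, HasDerivAt (fun r => ∫ s in (1 : ℝ)..r, massDeriv D lam Q s)
      (massDeriv D lam Q r) r := fun r =>
    (continuous_massDeriv D lam Q).integral_hasStrictDerivAt 1 r |>.hasDerivAt
  refine ⟨fun r => m 1 + ∫ s in (1 : ℝ)..r, massDeriv D lam Q s,
    fun r => (hI r).const_add _, ?_⟩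
  refine isOpen_Ioi.eqOn_of_deriv_eq isPreconnected_Ioi (x := (1 : ℝ))
    (fun r hr => (hm r hr).differentiableAt.differentiableWithinAt)
    (fun r _ => ((hI r).const_add _).differentiableAt.differentiableWithinAt) ?_
    (Set.mem_Ioi.2 one_pos) (by simp)
  intro r hr
  rw [((hI r).const_add _).deriv]
  exact (hm r hr).deriv

theorem massDeriv_zero (hD : 4 ≤ D) : massDeriv D lam Q 0 = 1 / lam ^ 2 * |lam * Q| := by
  rw [massDeriv, zero_pow (by omega), zero_pow (by omega), ← mul_pow, zero_add, sub_zero,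
    Real.sqrt_sq_eq_abs]

/-- This is `√(a² + b²) < a + b` for `a, b > 0`. -/
theorem massDeriv_lt (hD : 4 ≤ D) (hlam : lam ≠ 0) (hQ : Q ≠ 0) {r : ℝ} (hr : 0 < r) :
    massDeriv D lam Q r < massDeriv D lam Q 0 := by
  rw [massDeriv_zero hD, massDeriv]
  have hl : 0 < 1 / lam ^ 2 := by positivity
  refine mul_lt_mul_of_pos_left ?_ hl
  have hp : 0 < |lam * Q| := by positivity
  have hrn : 0 < r ^ (D - 2) := by positivity
  rw [sub_lt_iff_lt_add, Real.sqrt_lt' (by positivity), ← mul_pow, ← sq_abs (lam * Q), pow_mul']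
  nlinarith [mul_pos hp hrn]

theorem tendsto_div_self_of_hasDerivAt {M : ℝ → ℝ} {w : ℝ} (hM : HasDerivAt M w 0)
    (h0 : M 0 = 0) : Tendsto (fun r => M r / r) (𝓝[>] 0) (𝓝 w) := by
  have := hM.tendsto_slope_zero_right
  refine this.congr fun r => ?_
  simp [h0, div_eq_inv_mul]

/-- A zero of `f` means `2M(r) = r^(D-3)`. If `M 0 ≠ 0` the two sides have different limits. If `M 0
= 0`, dividing by `r` compares `2M'(0) > 0` with the limit of `r^(D-4)`, which separates them unless
`D = 4` and `2M'(0) = 1`. -/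
theorem lapse_eventually_ne_zero (hD : 4 ≤ D) (hlam : lam ≠ 0) (hQ : Q ≠ 0) {M : ℝ → ℝ}
    (hM : ∀ r, HasDerivAt M (massDeriv D lam Q r) r) (hmM : ∀ r, 0 < r → m r = M r) :
    ∀ᶠ r in 𝓝[>] 0, lapse D m r ≠ 0 := by
  have hpos : 0 < massDeriv D lam Q 0 := by
    rw [massDeriv_zero hD]
    positivity
  have key : ∀ r, 0 < r → 2 * M r ≠ r ^ (D - 3) → lapse D m r ≠ 0 := by
    intro r hr h h0
    apply h
    rw [lapse, hmM r hr, sub_eq_zero, eq_div_iff (by positivity), one_mul] at h0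
    exact h0.symm
  by_cases h0 : M 0 = 0
  · by_cases hcrit : D = 4 ∧ 2 * massDeriv D lam Q 0 = 1
    · obtain ⟨rfl, hc⟩ := hcrit
      filter_upwards [self_mem_nhdsWithin] with r hr
      refine key r hr ?_
      -- In the critical case the limits agree, but the mean value theorem and `M' < M'(0)` give
      -- `2M(r) < r` strictly.
      obtain ⟨c, hcmem, hslope⟩ := exists_hasDerivAt_eq_slope M (massDeriv 4 lam Q) hr
        (fun s _ => (hM s).continuousAt.continuousWithinAt) fun s _ => hM s
      have hlt := massDeriv_lt le_rfl hlam hQ hcmem.1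
      have hr' : (0 : ℝ) < r := hr
      rw [h0, sub_zero, sub_zero, eq_div_iff hr'.ne'] at hslope
      norm_num
      nlinarith
    · have hlim : Tendsto (fun r => 2 * (M r / r) - r ^ (D - 4)) (𝓝[>] 0)
          (𝓝 (2 * massDeriv D lam Q 0 - 0 ^ (D - 4))) :=
        ((tendsto_div_self_of_hasDerivAt (hM 0) h0).const_mul 2).sub
          ((continuous_pow (D - 4)).tendsto' (0 : ℝ) _ rfl |>.mono_left nhdsWithin_le_nhds)
      have hne : 2 * massDeriv D lam Q 0 - 0 ^ (D - 4) ≠ 0 := by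
        by_cases h4 : D = 4
        · have : 2 * massDeriv D lam Q 0 ≠ 1 := fun h => hcrit ⟨h4, h⟩
          rw [show D - 4 = 0 by omega, pow_zero]
          exact sub_ne_zero.2 this
        · rw [zero_pow (by omega)]
          linarith
      filter_upwards [hlim.eventually_ne hne, self_mem_nhdsWithin] with r h hr
      have hr' : (0 : ℝ) < r := hr
      refine key r hr fun h2 => h ?_
      rw [show D - 3 = D - 4 + 1 by omega, pow_succ] at h2
      field_simp
      linarith
  · have hlim : Tendsto (fun r => 2 * M r - r ^ (D - 3)) (𝓝[>] 0) (𝓝 (2 * M 0 - 0 ^ (D - 3))) :=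
      (((hM 0).continuousAt.const_mul 2).sub (continuousAt_id.pow (D - 3))).tendsto.mono_left
        nhdsWithin_le_nhds
    rw [zero_pow (by omega), sub_zero] at hlim
    filter_upwards [hlim.eventually_ne (mul_ne_zero two_ne_zero h0), self_mem_nhdsWithin] with r h hr
    exact key r hr (sub_ne_zero.1 h)

theorem tendsto_massBracket (hlam : lam ≠ 0) (hQ : Q ≠ 0) (hm : IsMassFunction D lam Q m)
    {M : ℝ → ℝ} (hM : ∀ r, HasDerivAt M (massDeriv D lam Q r) r)
    (hmM : ∀ r, 0 < r → m r = M r) :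
    Tendsto (massBracket D m) (𝓝[>] 0) (𝓝 (((D : ℝ) - 1) * ((D : ℝ) - 2) * M 0)) := by
  have hMc : Continuous M := continuous_iff_continuousAt.2 fun r => (hM r).continuousAt
  have h1 := continuous_massDeriv D lam Q
  have h2 := continuous_massDeriv2 D hlam hQ
  have hc : Continuous fun r => ((D : ℝ) - 1) * ((D : ℝ) - 2) * M r
      - 2 * ((D : ℝ) - 2) * r * massDeriv D lam Q r + r ^ 2 * massDeriv2 D lam Q r := by
    fun_prop
  have := (hc.tendsto' 0 (((D : ℝ) - 1) * ((D : ℝ) - 2) * M 0) (by simp)).mono_left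
    (nhdsWithin_le_nhds (s := Set.Ioi 0))
  refine this.congr' ?_
  filter_upwards [self_mem_nhdsWithin] with r hr
  rw [massBracket_eq hlam hQ hm hr, hmM r hr]

/-- With `M(r)/r → M'(0)` and `r m'' → 0`, the limit is `((D-1)(D-2) - 2(D-2)) M'(0)`, which is
non-zero. -/
theorem tendsto_massBracket_div (hlam : lam ≠ 0) (hQ : Q ≠ 0) (hm : IsMassFunction D lam Q m)
    {M : ℝ → ℝ} (hM : ∀ r, HasDerivAt M (massDeriv D lam Q r) r)
    (hmM : ∀ r, 0 < r → m r = M r) (h0 : M 0 = 0) :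
    Tendsto (fun r => massBracket D m r / r) (𝓝[>] 0)
      (𝓝 (((D : ℝ) - 2) * ((D : ℝ) - 3) * massDeriv D lam Q 0)) := by
  have h1 := continuous_massDeriv D lam Q
  have h2 := continuous_massDeriv2 D hlam hQ
  have hc : Continuous fun r => - 2 * ((D : ℝ) - 2) * massDeriv D lam Q r
      + r * massDeriv2 D lam Q r := by
    fun_prop
  have h3 := (hc.tendsto' 0 (- 2 * ((D : ℝ) - 2) * massDeriv D lam Q 0) (by simp)).mono_left
    (nhdsWithin_le_nhds (s := Set.Ioi 0))
  have h4 := ((tendsto_div_self_of_hasDerivAt (hM 0) h0).const_mul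
    (((D : ℝ) - 1) * ((D : ℝ) - 2))).add h3
  have he : ((D : ℝ) - 1) * ((D : ℝ) - 2) * massDeriv D lam Q 0
      + - 2 * ((D : ℝ) - 2) * massDeriv D lam Q 0
      = ((D : ℝ) - 2) * ((D : ℝ) - 3) * massDeriv D lam Q 0 := by ring
  rw [he] at h4
  refine h4.congr' ?_
  filter_upwards [self_mem_nhdsWithin] with r hr
  have hr' : (0 : ℝ) < r := hr
  rw [massBracket_eq hlam hQ hm hr, hmM r hr]
  field_simp
  ring

theorem tendsto_one_div_pow_atTop {n : ℕ} (hn : n ≠ 0) :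
    Tendsto (fun r : ℝ => 1 / r ^ n) (𝓝[>] 0) atTop := by
  have h := (tendsto_pow_atTop hn).comp (tendsto_inv_nhdsGT_zero (𝕜 := ℝ))
  refine h.congr fun r => ?_
  simp

theorem tendsto_electricField (hD : 4 ≤ D) (hlam : lam ≠ 0) (hQ : Q ≠ 0) :
    Tendsto (electricField D lam Q) (𝓝[>] 0) (𝓝 (Q / |lam * Q|)) := by
  have hc : Continuous (electricField D lam Q) := by
    have h : ∀ r : ℝ, √(r ^ (2 * (D - 2)) + lam ^ 2 * Q ^ 2) ≠ 0 := fun r =>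
      (Real.sqrt_pos.2 (radicand_pos hlam hQ (D - 2) r)).ne'
    unfold electricField
    fun_prop (disch := exact h)
  refine (hc.tendsto' 0 _ ?_).mono_left nhdsWithin_le_nhds
  rw [electricField, zero_pow (by omega), zero_add, ← mul_pow, Real.sqrt_sq_eq_abs]

end

end

end BornInfeld

/-! ### Assembly of the theorem. -/

open BornInfeld in
theorem mainTheorem7 (D : ℕ) (hD : 4 ≤ D) (lam Q : ℝ) (hlam : lam ≠ 0) (hQ : Q ≠ 0)
    (m : ℝ → ℝ) (hm : BornInfeld.IsMassFunction D lam Q m) :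
    (∀ (t r : ℝ) (u : Fin (D - 2) → ℝ), 0 < r → BornInfeld.lapse D m r ≠ 0 →
      BornInfeld.conjugateField lam (BornInfeld.metric D m) (BornInfeld.maxwell D lam Q)
          (BornInfeld.point t r u)
        = BornInfeld.radialForm D (Q / r ^ (D - 2)) ∧
      (∀ a b c d : BornInfeld.Idx D,
        BornInfeld.weyl (BornInfeld.metric D m) (BornInfeld.point t r u) a b c d
          = -(2 * r ^ (D - 3) / (3 * Q ^ 2)) * BornInfeld.massBracket D m r *
            BornInfeld.doubling (BornInfeld.metric D m (BornInfeld.point t r u))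
              (BornInfeld.conjugateField lam (BornInfeld.metric D m) (BornInfeld.maxwell D lam Q)
                (BornInfeld.point t r u)) a b c d) ∧
      BornInfeld.weylSq (BornInfeld.metric D m) (BornInfeld.point t r u)
        = 4 * ((D : ℝ) - 3) / (((D : ℝ) - 1) * r ^ (2 * (D - 1)))
            * BornInfeld.massBracket D m r ^ 2) ∧
    (∃ m₀ : ℝ, Tendsto m (𝓝[>] 0) (𝓝 m₀) ∧
      (∀ (t : ℝ) (u : Fin (D - 2) → ℝ),
        Tendsto (fun r => BornInfeld.weylSq (BornInfeld.metric D m) (BornInfeld.point t r u))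
          (𝓝[>] 0) atTop ∧
        Tendsto (fun r => r ^ (2 * (D - 1)) *
            BornInfeld.weylSq (BornInfeld.metric D m) (BornInfeld.point t r u))
          (𝓝[>] 0) (𝓝 (4 * ((D : ℝ) - 1) * ((D : ℝ) - 2) ^ 2 * ((D : ℝ) - 3) * m₀ ^ 2)) ∧
        (m₀ ≠ 0 →
          (fun r => BornInfeld.weylSq (BornInfeld.metric D m) (BornInfeld.point t r u))
            =Θ[𝓝[>] 0] (fun r : ℝ => 1 / r ^ (2 * (D - 1)))))) ∧
    Tendsto (BornInfeld.electricField D lam Q) (𝓝[>] 0) (𝓝 (Q / |lam * Q|)) := by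
  have hD' : (4 : ℝ) ≤ D := by exact_mod_cast hD
  have h1 : (D : ℝ) - 1 ≠ 0 := by linarith
  have h2 : (D : ℝ) - 2 ≠ 0 := by linarith
  have h3 : (D : ℝ) - 3 ≠ 0 := by linarith
  refine ⟨?_, ?_, tendsto_electricField hD hlam hQ⟩
  · intro t r u hr h0
    have hG := conjugateField_maxwell (D := D) (m := m) (x := point t r u) hlam hQ hr h0
    refine ⟨hG, ?_, weylSq_massFunction hD hlam hQ hm (x := point t r u) hr h0⟩
    intro a b c d
    rw [hG, weyl_massFunction hD hlam hQ hm (x := point t r u) hr h0,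
      doubling_radialForm hD (x := point t r u) hr h0]
    change _ * (massBracket D m r / r ^ (D - 1)) * _ * _
      = _ * (-(3 / 2) * (Q / r ^ (D - 2)) ^ 2 * _ * _ * _)
    -- Writing `D = p + 3` removes the truncated exponents; what remains is `r^(D-3) / r^(2(D-2)) =
    -- 1 / r^(D-1)`.
    obtain ⟨p, rfl⟩ : ∃ p, D = p + 3 := ⟨D - 3, by omega⟩
    simp only [show p + 3 - 1 = p + 2 by omega, show p + 3 - 2 = p + 1 by omega,
      Nat.add_sub_cancel]
    field_simp
    ring
  · obtain ⟨M, hM, hmM⟩ := hm.exists_extension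
    have hMt : Tendsto m (𝓝[>] 0) (𝓝 (M 0)) :=
      ((hM 0).continuousAt.tendsto.mono_left nhdsWithin_le_nhds).congr'
        (by filter_upwards [self_mem_nhdsWithin] with r hr using (hmM r hr).symm)
    refine ⟨M 0, hMt, fun t u => ?_⟩
    have hsq : ∀ᶠ r in 𝓝[>] 0, weylSq (metric D m) (point t r u)
        = 4 * ((D : ℝ) - 3) / (((D : ℝ) - 1) * r ^ (2 * (D - 1))) * massBracket D m r ^ 2 := by
      filter_upwards [lapse_eventually_ne_zero hD hlam hQ hM hmM, self_mem_nhdsWithin] with r h0 hr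
      exact weylSq_massFunction hD hlam hQ hm (x := point t r u) hr h0
    have hlim : Tendsto (fun r => r ^ (2 * (D - 1)) * weylSq (metric D m) (point t r u)) (𝓝[>] 0)
        (𝓝 (4 * ((D : ℝ) - 1) * ((D : ℝ) - 2) ^ 2 * ((D : ℝ) - 3) * M 0 ^ 2)) := by
      have h := ((tendsto_massBracket hlam hQ hm hM hmM).pow 2).const_mul
        (4 * ((D : ℝ) - 3) / ((D : ℝ) - 1))
      have he : 4 * ((D : ℝ) - 3) / ((D : ℝ) - 1) * (((D : ℝ) - 1) * ((D : ℝ) - 2) * M 0) ^ 2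
          = 4 * ((D : ℝ) - 1) * ((D : ℝ) - 2) ^ 2 * ((D : ℝ) - 3) * M 0 ^ 2 := by
        field_simp
      rw [he] at h
      refine h.congr' ?_
      filter_upwards [hsq, self_mem_nhdsWithin] with r hs hr
      have hr' : (0 : ℝ) < r := hr
      rw [hs]
      field_simp
    have hpos : M 0 ≠ 0 →
        0 < 4 * ((D : ℝ) - 1) * ((D : ℝ) - 2) ^ 2 * ((D : ℝ) - 3) * M 0 ^ 2 := by
      intro h0
      have h1 : 0 < (D : ℝ) - 1 := by linarith
      have h3 : 0 < (D : ℝ) - 3 := by linarith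
      positivity
    refine ⟨?_, hlim, fun h0 => ?_⟩
    -- If `M 0 = 0`, the rescaled limit is zero and says nothing about divergence; the factor `r²`
    -- contained in `B²` is extracted instead, leaving `r^(-2(D-2))`.
    · by_cases h0 : M 0 = 0
      · have hw : 0 < massDeriv D lam Q 0 := by
          rw [massDeriv_zero hD]
          positivity
        have hc : 0 < 4 * ((D : ℝ) - 3) / ((D : ℝ) - 1)
            * (((D : ℝ) - 2) * ((D : ℝ) - 3) * massDeriv D lam Q 0) ^ 2 := by
          have h1 : 0 < (D : ℝ) - 1 := by linarith
          have h3 : 0 < (D : ℝ) - 3 := by linarith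
          positivity
        have h := (((tendsto_massBracket_div hlam hQ hm hM hmM h0).pow 2).const_mul
          (4 * ((D : ℝ) - 3) / ((D : ℝ) - 1))).pos_mul_atTop hc
          (tendsto_one_div_pow_atTop (n := 2 * (D - 2)) (by omega))
        refine h.congr' ?_
        filter_upwards [hsq, self_mem_nhdsWithin] with r hs hr
        have hr' : (0 : ℝ) < r := hr
        rw [hs, show 2 * (D - 1) = 2 * (D - 2) + 2 by omega, pow_add]
        field_simp
      · refine (hlim.pos_mul_atTop (hpos h0)
          (tendsto_one_div_pow_atTop (n := 2 * (D - 1)) (by omega))).congr' ?_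
        filter_upwards [self_mem_nhdsWithin] with r hr
        have hr' : (0 : ℝ) < r := hr
        field_simp
    · refine (isTheta_of_div_tendsto_nhds_ne_zero (hlim.congr fun r => ?_) (hpos h0).ne').symm
      rw [div_div_eq_mul_div, div_one, mul_comm]
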